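/- Let $\ell\ge 1$ and $\psi:\{0,1\}^\ell\to\mathbb{R}$ be fixed. For $n\ge1$ let $\tau$ be a uniformly random permutation of $\{1,\dots,n\}$, and for $0\le m\le n$ and $1\le k\le n$ let $I_{n,m}(k)=1$ if $\tau^{-1}(k)\le m$ and $I_{n,m}(k)=0$ otherwise, extended to all $k\in\mathbb{Z}$ by $I_{n,m}(k+n)=I_{n,m}(k)$. Put $$\bar X_{n,m}=\sum_{k=1}^n\psi\bigl(I_{n,m}(k),\dots,I_{n,m}(k+\ell-1)\bigr),\qquad \bar X_n^*=\max_{0\le m\le n}\bar X_{n,m}.$$ For $0\le t\le1$ let $g_0(t)=\mathbb{E}\,\psi(\xi_1,\dots,\xi_\ell)$ with $\xi_1,\dots,\xi_\ell$ independent Bernoulli variables of parameter $t$. Let $\mathcal{A}$ be the set of finite strings $\alpha$ of 0's and 1's that begin and end with 1, and let $\ell(\alpha)$ be the length of $\alpha$ and $\nu(\alpha)$ the number of 1's in $\alpha$. Let $g_\alpha(t)$, for $\alpha\in\mathcal{A}$ with $\ell(\alpha)\le\ell$, be the polynomials for which $$\sum_{k=1}^n\psi(x_k,\dots,x_{k+\ell-1})=g_0(t)\,n+\sum_{\alpha\in\mathcal{A},\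 \ell(\alpha)\le\ell}g_\alpha(t)\sum_{k=1}^n\ \prod_{j:\,\alpha_j=1}(x_{k+j}-t)$$ for all $n\ge2\ell$, all $x\in\{0,1\}^n$ (indices modulo $n$) and all $t\in[0,1]$. Explicitly, if $c_B(t)$ is the coefficient of $\prod_{j\in B}(x_j-t)$ when $\psi(x_1,\dots,x_\ell)$ is written as a linear combination of the products $\prod_{j\in B}(x_j-t)$, $B\subseteq\{1,\dots,\ell\}$, then $g_\alpha=\sum_B c_B$, summed over the $B$ whose indicator string equals $\alpha$ after deletion of initial and final 0's. Suppose that $g_0$ has a unique maximum on $[0,1]$, at an interior point $t_0\in(0,1)$, and that $g_0''(t_0)<0$. Then, as $n\to\infty$, $$n^{-1/2}\bigl(\bar X_n^*-g_0(t_0)\,n\bigr)\ \xrightarrow{\ d\ }\ N(0,\sigma^2),\qquad \sigma^2=\sum_{\alpha\in\mathcal{A},\ \ell(\alpha)\le\ell}g_\alpha(t_0)^2\bigl(t_0(1-t_0)\bigr)^{\nu(\alpha)},$$ with convergence of all moments: for every integer $r\ge0$, the $r$-th moment of $n^{-1/2}(\bar X_n^*-g_0(t_0)n)$ converges to the $r$-th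 moment of $N(0,\sigma^2)$. -/

import Mathlib

open MeasureTheory ProbabilityTheory Filter Topology

namespace PatternMax

noncomputable section

/-! ### The randomly evolving cyclic 0/1 sequence -/

/-- The position `k + j`, read modulo `n`. Positions are numbered `0, …, n - 1`. -/
def cyc {n : ℕ} (k : Fin n) (j : ℕ) : Fin n :=
  ⟨((k : ℕ) + j) % n, Nat.mod_lt _ (Nat.lt_of_le_of_lt (Nat.zero_le _) k.isLt)⟩

/-- The indicator `I_{n,m}(k)`: item `k` is one of the `m` first in the input given by the
permutation `τ`, i.e. its (0-based) position `τ⁻¹ k` in the input is less than `m`. -/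
def indicator {n : ℕ} (τ : Equiv.Perm (Fin n)) (m : ℕ) (k : Fin n) : Bool :=
  decide ((τ.symm k : ℕ) < m)

/-- `∑_k ψ (x_k, …, x_{k+ℓ-1})`, for a cyclic 0/1 sequence `x` of length `n`. -/
def localSum {ℓ : ℕ} (ψ : (Fin ℓ → Bool) → ℝ) {n : ℕ} (x : Fin n → Bool) : ℝ :=
  ∑ k : Fin n, ψ (fun j => x (cyc k j))

/-- The functional `X̄_{n,m} = ∑_k ψ (I_{n,m}(k), …, I_{n,m}(k+ℓ-1))`. -/
def patternCount {ℓ : ℕ} (ψ : (Fin ℓ → Bool) → ℝ) {n : ℕ} (τ : Equiv.Perm (Fin n)) (m : ℕ) : ℝ :=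
  localSum ψ (indicator τ m)

/-- `X̄*_n = max_{0 ≤ m ≤ n} X̄_{n,m}`. -/
def maxPatternCount {ℓ : ℕ} (ψ : (Fin ℓ → Bool) → ℝ) {n : ℕ} (τ : Equiv.Perm (Fin n)) : ℝ :=
  (Finset.range (n + 1)).sup' Finset.nonempty_range_add_one (fun m => patternCount ψ τ m)

/-! ### The uniform random permutation -/

instance permMeasurableSpace (n : ℕ) : MeasurableSpace (Equiv.Perm (Fin n)) := ⊤

/-- The uniform distribution on the permutations of `n` items. -/
def permMeasure (n : ℕ) : Measure (Equiv.Perm (Fin n)) :=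
  (PMF.uniformOfFintype (Equiv.Perm (Fin n))).toMeasure

instance permMeasure_isProbabilityMeasure (n : ℕ) : IsProbabilityMeasure (permMeasure n) := by
  unfold permMeasure; infer_instance

/-! ### The polynomials `g_0` and `g_α`

A string `α` of 0's and 1's that begins and ends with 1 is encoded by the set of the places of
its 1's, counted from its first symbol, which has place 0. Thus strings `α` with `ℓ(α) ≤ ℓ`
correspond to the subsets of `{0, …, ℓ - 1}` that contain `0`, and `ν(α)` is the cardinality. -/

/-- The strings `α` of length at most `ℓ` that begin and end with 1. -/
def strings (ℓ : ℕ) : Finset (Finset ℕ) :=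
  (Finset.range ℓ).powerset.filter (fun A => 0 ∈ A)

/-- 0 or 1 as a real number. -/
def bit (b : Bool) : ℝ := if b then 1 else 0

/-- The weight of the value `b` for a Bernoulli variable with parameter `t`. -/
def bern (t : ℝ) (b : Bool) : ℝ := if b then t else 1 - t

/-- The mean profile `g_0(t) = E ψ(ξ_1, …, ξ_ℓ)`, with `ξ_j` independent and Bernoulli of
parameter `t`. -/
def meanProfile {ℓ : ℕ} (ψ : (Fin ℓ → Bool) → ℝ) (t : ℝ) : ℝ :=
  ∑ x : Fin ℓ → Bool, ψ x * ∏ j, bern t (x j)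

/-- The coefficient of `∏_{j ∈ B} (ξ_j - t)` in the expansion of `ψ(ξ_1, …, ξ_ℓ)`: the mixed
difference of `ψ` in the variables of `B`, averaged over the other variables. -/
def coeff {ℓ : ℕ} (ψ : (Fin ℓ → Bool) → ℝ) (B : Finset (Fin ℓ)) (t : ℝ) : ℝ :=
  ∑ x : Fin ℓ → Bool, ψ x * ((∏ j ∈ B, (if x j then (1 : ℝ) else -1)) * ∏ j ∈ Bᶜ, bern t (x j))

/-- The places of the 1's, after deletion of the initial and the final 0's. -/
def trim (C : Finset ℕ) : Finset ℕ := C.image (fun j => j - sInf (C : Set ℕ))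

/-- The coefficient `g_α(t)`: the sum of the coefficients over all sets `B` of places in a window
of length `ℓ` that show the string `α` up to initial and final 0's. -/
def stringCoeff {ℓ : ℕ} (ψ : (Fin ℓ → Bool) → ℝ) (A : Finset ℕ) (t : ℝ) : ℝ :=
  ∑ B : Finset (Fin ℓ) with trim (B.image (fun j : Fin ℓ => (j : ℕ))) = A, coeff ψ B t

/-- `S_α(t) = ∑_k ∏_{j : α_j = 1} (x_{k+j} - t)`, for a cyclic 0/1 sequence `x`. -/
def stringSum (A : Finset ℕ) (t : ℝ) {n : ℕ} (x : Fin n → Bool) : ℝ :=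
  ∑ k : Fin n, ∏ a ∈ A, (bit (x (cyc k a)) - t)

/-- `σ² = ∑_α g_α(t)² (t (1 - t))^{ν(α)}`. -/
def limitVariance {ℓ : ℕ} (ψ : (Fin ℓ → Bool) → ℝ) (t : ℝ) : ℝ :=
  ∑ A ∈ strings ℓ, stringCoeff ψ A t ^ 2 * (t * (1 - t)) ^ A.card

theorem limitVariance_nonneg {ℓ : ℕ} (ψ : (Fin ℓ → Bool) → ℝ) {t : ℝ} (ht : t ∈ Set.Icc (0 : ℝ) 1) :
    0 ≤ limitVariance ψ t :=
  Finset.sum_nonneg fun _ _ =>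
    mul_nonneg (sq_nonneg _) (pow_nonneg (mul_nonneg ht.1 (sub_nonneg.2 ht.2)) _)

/-! ### The defining property of the coefficients -/

theorem coeff_empty {ℓ : ℕ} (ψ : (Fin ℓ → Bool) → ℝ) (t : ℝ) :
    coeff ψ ∅ t = meanProfile ψ t := by
  simp [coeff, meanProfile]

theorem window_expansion {ℓ : ℕ} (ψ : (Fin ℓ → Bool) → ℝ) (t : ℝ) (y : Fin ℓ → Bool) :
    ψ y = ∑ B : Finset (Fin ℓ), coeff ψ B t * ∏ j ∈ B, (bit (y j) - t) := by
  have key : ∀ x : Fin ℓ → Bool,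
      (∏ j, ((if x j then (1 : ℝ) else -1) * (bit (y j) - t) + bern t (x j)))
        = if x = y then 1 else 0 := by
    intro x
    split_ifs with h
    · subst h
      refine Finset.prod_eq_one fun j _ => ?_
      cases hx : x j <;> simp [bit, bern]
    · obtain ⟨j, hj⟩ := Function.ne_iff.1 h
      refine Finset.prod_eq_zero (Finset.mem_univ j) ?_
      cases hx : x j <;> cases hy : y j <;> simp_all [bit, bern]
  calc ψ y = ∑ x : Fin ℓ → Bool, ψ x * (if x = y then 1 else 0) := by simp
    _ = ∑ x : Fin ℓ → Bool, ∑ B : Finset (Fin ℓ),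
          ψ x * ((∏ j ∈ B, (if x j then (1 : ℝ) else -1)) * ∏ j ∈ Bᶜ, bern t (x j))
            * ∏ j ∈ B, (bit (y j) - t) := by
        refine Finset.sum_congr rfl fun x _ => ?_
        rw [← key x, Fintype.prod_add, Finset.mul_sum]
        refine Finset.sum_congr rfl fun B _ => ?_
        rw [Finset.prod_mul_distrib]
        ring
    _ = _ := by
        rw [Finset.sum_comm]
        refine Finset.sum_congr rfl fun B _ => ?_
        rw [coeff, Finset.sum_mul]

theorem cyc_cyc {n : ℕ} (k : Fin n) (i j : ℕ) : cyc (cyc k i) j = cyc k (i + j) := by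
  apply Fin.ext
  simp [cyc, Nat.add_assoc]

theorem cyc_bijective (n i : ℕ) : Function.Bijective (fun k : Fin n => cyc k i) := by
  refine Finite.injective_iff_bijective.1 fun k k' h => ?_
  have h1 : ((k : ℕ) + i) % n = ((k' : ℕ) + i) % n := congrArg Fin.val h
  have h2 : (k : ℕ) % n = (k' : ℕ) % n := Nat.ModEq.add_right_cancel' i h1
  rw [Nat.mod_eq_of_lt k.isLt, Nat.mod_eq_of_lt k'.isLt] at h2
  exact Fin.ext h2

/-- Initial and final 0's do not affect `S_α`. -/
theorem stringSum_trim {n : ℕ} (C : Finset ℕ) (t : ℝ) (x : Fin n → Bool) :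
    stringSum (trim C) t x = stringSum C t x := by
  have hle : ∀ j ∈ C, sInf (C : Set ℕ) ≤ j := fun j hj => Nat.sInf_le hj
  have hC : ∀ k : Fin n, ∏ a ∈ C, (bit (x (cyc k a)) - t)
      = ∏ a ∈ trim C, (bit (x (cyc (cyc k (sInf (C : Set ℕ))) a)) - t) := by
    intro k
    rw [trim, Finset.prod_image]
    · refine Finset.prod_congr rfl fun j hj => ?_
      rw [cyc_cyc, Nat.add_sub_of_le (hle j hj)]
    · intro a ha b hb hab
      have h1 := hle a ha
      have h2 := hle b hb
      simp only at hab
      omega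
  unfold stringSum
  simp_rw [hC]
  exact ((cyc_bijective n _).sum_comp
    (fun k => ∏ a ∈ trim C, (bit (x (cyc k a)) - t))).symm

theorem trim_mem_strings {ℓ : ℕ} (B : Finset (Fin ℓ)) (hB : B.Nonempty) :
    trim (B.image (fun j : Fin ℓ => (j : ℕ))) ∈ strings ℓ := by
  set C := B.image (fun j : Fin ℓ => (j : ℕ)) with hC
  have hCne : (C : Set ℕ).Nonempty := by
    rw [Finset.coe_nonempty]; exact hB.image _
  have hmem : sInf (C : Set ℕ) ∈ C := Nat.sInf_mem hCne
  simp only [strings, Finset.mem_filter, Finset.mem_powerset, trim]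
  refine ⟨fun a ha => ?_, Finset.mem_image.2 ⟨_, hmem, Nat.sub_self _⟩⟩
  obtain ⟨j, hj, rfl⟩ := Finset.mem_image.1 ha
  obtain ⟨i, _, rfl⟩ := Finset.mem_image.1 hj
  exact Finset.mem_range.2 (lt_of_le_of_lt (Nat.sub_le _ _) i.isLt)

/-- The expansion `X_n(t) = g_0(t) n + ∑_α g_α(t) S_α(t)` that defines the coefficients. -/
theorem localSum_expansion {ℓ : ℕ} (ψ : (Fin ℓ → Bool) → ℝ) (t : ℝ) {n : ℕ} (x : Fin n → Bool) :
    localSum ψ x = meanProfile ψ t * n + ∑ A ∈ strings ℓ, stringCoeff ψ A t * stringSum A t x := by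
  have himg : ∀ B : Finset (Fin ℓ), ∑ k : Fin n, ∏ j ∈ B, (bit (x (cyc k j)) - t)
      = stringSum (trim (B.image (fun j : Fin ℓ => (j : ℕ)))) t x := by
    intro B
    rw [stringSum_trim, stringSum]
    refine Finset.sum_congr rfl fun k _ => ?_
    rw [Finset.prod_image]
    exact fun a _ b _ h => Fin.ext h
  have h1 : localSum ψ x = ∑ B : Finset (Fin ℓ),
      coeff ψ B t * stringSum (trim (B.image (fun j : Fin ℓ => (j : ℕ)))) t x := by
    unfold localSum
    rw [Finset.sum_congr rfl fun k _ => window_expansion ψ t (fun j : Fin ℓ => x (cyc k j)),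
      Finset.sum_comm]
    refine Finset.sum_congr rfl fun B _ => ?_
    rw [← himg, Finset.mul_sum]
  have hfib : ∀ A ∈ strings ℓ, (Finset.univ.filter fun B : Finset (Fin ℓ) =>
        trim (B.image (fun j : Fin ℓ => (j : ℕ))) = A)
      = (Finset.univ.erase (∅ : Finset (Fin ℓ))).filter fun B =>
        trim (B.image (fun j : Fin ℓ => (j : ℕ))) = A := by
    intro A hA
    ext B
    simp only [Finset.mem_filter, Finset.mem_univ, true_and, Finset.mem_erase, and_true]
    refine ⟨fun h => ⟨?_, h⟩, fun h => h.2⟩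
    rintro rfl
    have h0 : (0 : ℕ) ∈ A := (Finset.mem_filter.1 hA).2
    rw [← h] at h0
    simp [trim] at h0
  rw [h1, ← Finset.add_sum_erase _ _ (Finset.mem_univ (∅ : Finset (Fin ℓ)))]
  congr 1
  · simp [coeff_empty, trim, stringSum]
  · rw [← Finset.sum_fiberwise_of_maps_to (t := strings ℓ)
      (g := fun B : Finset (Fin ℓ) => trim (B.image (fun j : Fin ℓ => (j : ℕ))))]
    · refine Finset.sum_congr rfl fun A hA => ?_
      rw [stringCoeff, hfib A hA, Finset.sum_mul]
      refine Finset.sum_congr rfl fun B hB => ?_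
      rw [(Finset.mem_filter.1 hB).2]
    · intro B hB
      exact trim_mem_strings B (Finset.nonempty_iff_ne_empty.2 (Finset.ne_of_mem_erase hB))

/-- The normalized maximum `n^{-1/2} (X̄*_n - g_0(t₀) n)`. -/
def normalizedMax {ℓ : ℕ} (ψ : (Fin ℓ → Bool) → ℝ) (t₀ : ℝ) (n : ℕ)
    (τ : Equiv.Perm (Fin n)) : ℝ :=
  (√(n : ℝ))⁻¹ * (maxPatternCount ψ τ - meanProfile ψ t₀ * n)

end

end PatternMax

namespace PatternMax

noncomputable section

/-! ### Expectations of functions of finitely many i.i.d. variables -/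

/-! Take an independent binomial time $M\sim\mathrm{Bin}(n,t_0)$. The sequence $I_{n,M}$ is then
i.i.d. Bernoulli($t_0$) (`iidMean_permMean_indicator`), so $\bar X_{n,M}$ is a local functional of
an i.i.d. sequence, with no extra term from the randomness of permutations. Two facts suffice: $\bar
X_{n,M}$ satisfies the central limit theorem, and $n^{-1/2}(\bar X_n^*-\bar X_{n,M})\to0$ in every
$L^q$.

For the first, the sums $S_\alpha(t_0)$ are orthogonal, which gives the variance $n\sigma^2$ exactly
once $n\ge2\ell$ (`iidMean_sq_localSum`). Local dependence makes the characteristic function almost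
satisfy $f'=-\sigma^2uf$ (`norm_charFun_deriv_add_le`), and an integrating factor turns this into
convergence (`tendsto_charFun_normalizedSum`).

For the second, write $a=n^{1/20}$, so that $\sqrt n=a^{10}$. With probability
$1-O(\mathrm{poly}(a)e^{-a})$, all deviations of $\bar X_{n,m}$ from its mean profile, relative to
time 0, are at most $a^{11}$, those over time intervals of length at most $2a^{16}$ are at most
$\varepsilon a^{10}$, and $|M-nt_0|\le a^{11}$. If $|m-nt_0|>a^{16}$, the quadratic maximum of $g_0$
costs at least $ca^{12}$, more than fluctuations can recover; if $m$ is nearer, $\bar X_{n,m}$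
exceeds $\bar X_{n,M}$ by at most $2\varepsilon a^{10}$ (`patternCount_sub_le_of_deviation_le`). On
the exceptional event the gap is still $O(\sqrt n)$, so all its moments vanish in the limit
(`tendsto_maxGap_moment`).

The deviation bounds for permutations come from i.i.d. sequences with three states (early, middle,
late): conditioning on the counts costs only a factor $(n+1)^2$ (`permMean_stage_le`), harmless
against $e^{-a}$. -/

theorem dependsOn_prod {ι S κ R : Type*} [DecidableEq ι] [DecidableEq κ] [CommRing R] (c : Finset κ)
    {f : κ → (ι → S) → R}
    {N : κ → Finset ι} (hf : ∀ k, DependsOn (f k) (N k : Set ι)) :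
    DependsOn (fun x => ∏ k ∈ c, f k x) (c.biUnion N : Set ι) := by
  intro x y h
  refine Finset.prod_congr rfl fun k hk => hf k fun i hi => h i ?_
  exact Finset.mem_coe.2 (Finset.mem_biUnion.2 ⟨k, hk, hi⟩)

theorem dependsOn_sum {ι S κ R : Type*} [DecidableEq ι] [DecidableEq κ] [AddCommGroup R] (c : Finset κ)
    {f : κ → (ι → S) → R}
    {N : κ → Finset ι} (hf : ∀ k, DependsOn (f k) (N k : Set ι)) :
    DependsOn (fun x => ∑ k ∈ c, f k x) (c.biUnion N : Set ι) := by
  intro x y h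
  refine Finset.sum_congr rfl fun k hk => hf k fun i hi => h i ?_
  exact Finset.mem_coe.2 (Finset.mem_biUnion.2 ⟨k, hk, hi⟩)

section IidMean

variable {ι S : Type*} [Fintype ι] [DecidableEq ι] [Fintype S]

/-- The expectation of `f (ξ_i)_i`, where the `ξ_i` are independent with the weights `w`. -/
def iidMean {E : Type*} [AddCommGroup E] [Module ℝ E] (w : S → ℝ) (f : (ι → S) → E) : E :=
  ∑ x : ι → S, (∏ i, w (x i)) • f x

theorem sum_prod_weight {w : S → ℝ} (hw : ∑ s, w s = 1) : ∑ x : ι → S, ∏ i, w (x i) = 1 := by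
  have := Finset.prod_univ_sum (fun _ : ι => (Finset.univ : Finset S)) (fun _ s => w s)
  rw [Fintype.piFinset_univ] at this
  rw [← this]
  simp [hw]

section Module

variable {E : Type*} [AddCommGroup E] [Module ℝ E] (w : S → ℝ)

theorem iidMean_add (f g : (ι → S) → E) :
    iidMean w (fun x => f x + g x) = iidMean w f + iidMean w g := by
  simp [iidMean, Finset.sum_add_distrib]

theorem iidMean_sub (f g : (ι → S) → E) :
    iidMean w (fun x => f x - g x) = iidMean w f - iidMean w g := by
  simp [iidMean, smul_sub, Finset.sum_sub_distrib]

theorem iidMean_sum {κ : Type*} (s : Finset κ) (f : κ → (ι → S) → E) :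
    iidMean w (fun x => ∑ k ∈ s, f k x) = ∑ k ∈ s, iidMean w (f k) := by
  simp only [iidMean, Finset.smul_sum]
  exact Finset.sum_comm

theorem iidMean_const {w : S → ℝ} (hw : ∑ s, w s = 1) (c : E) :
    iidMean w (fun _ : ι → S => c) = c := by
  rw [iidMean, ← Finset.sum_smul, sum_prod_weight hw, one_smul]

theorem iidMean_comp_perm (σ : Equiv.Perm ι) (f : (ι → S) → E) :
    iidMean w (fun x => f (x ∘ σ)) = iidMean w f := by
  unfold iidMean
  rw [← Equiv.sum_comp (Equiv.arrowCongr σ.symm (Equiv.refl S)) (fun x => (∏ i, w (x i)) • f x)]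
  refine Finset.sum_congr rfl fun x _ => ?_
  have : (Equiv.arrowCongr σ.symm (Equiv.refl S)) x = x ∘ σ := by
    ext i; simp [Equiv.arrowCongr]
  rw [this]
  congr 1
  exact (Equiv.prod_comp σ (fun i => w (x i))).symm

end Module

theorem iidMean_const_mul {R : Type*} [Ring R] [Algebra ℝ R] (w : S → ℝ) (c : R)
    (f : (ι → S) → R) : iidMean w (fun x => c * f x) = c * iidMean w f := by
  simp [iidMean, Finset.mul_sum]

theorem iidMean_mono {w : S → ℝ} (hw : ∀ s, 0 ≤ w s) {f g : (ι → S) → ℝ} (h : ∀ x, f x ≤ g x) :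
    iidMean w f ≤ iidMean w g :=
  Finset.sum_le_sum fun x _ =>
    smul_le_smul_of_nonneg_left (h x) (Finset.prod_nonneg fun _ _ => hw _)

theorem iidMean_nonneg {w : S → ℝ} (hw : ∀ s, 0 ≤ w s) {f : (ι → S) → ℝ} (h : ∀ x, 0 ≤ f x) :
    0 ≤ iidMean w f :=
  Finset.sum_nonneg fun x _ => smul_nonneg (Finset.prod_nonneg fun _ _ => hw _) (h x)

theorem norm_iidMean_le {E : Type*} [NormedAddCommGroup E] [NormedSpace ℝ E] {w : S → ℝ}
    (hw : ∀ s, 0 ≤ w s) (f : (ι → S) → E) : ‖iidMean w f‖ ≤ iidMean w (fun x => ‖f x‖) := by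
  refine (norm_sum_le _ _).trans (Finset.sum_le_sum fun x _ => ?_)
  rw [norm_smul, Real.norm_of_nonneg (Finset.prod_nonneg fun i _ => hw _), smul_eq_mul]

/-- Functions of disjoint sets of coordinates are independent. -/
theorem iidMean_mul_of_disjoint {R : Type*} [Ring R] [Algebra ℝ R] {w : S → ℝ}
    (hw : ∑ s, w s = 1) {f g : (ι → S) → R} {A B : Finset ι}
    (hf : DependsOn f (A : Set ι)) (hg : DependsOn g (B : Set ι)) (hAB : Disjoint A B) :
    iidMean w (fun x => f x * g x) = iidMean w f * iidMean w g := by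
  -- Two independent copies exchange their coordinates outside `A`. This preserves the product
  -- weight, fixes the value of `f` on the first copy and replaces that of `g` by its value on the
  -- second.
  let e : ((ι → S) × (ι → S)) ≃ ((ι → S) × (ι → S)) :=
    Function.Involutive.toPerm
      (fun p => (A.piecewise p.1 p.2, A.piecewise p.2 p.1)) (by
        rintro ⟨x, y⟩
        ext i <;> by_cases hi : i ∈ A <;> simp [hi])
  have he : ∀ p, e p = (A.piecewise p.1 p.2, A.piecewise p.2 p.1) := fun _ => rfl
  let W : (ι → S) → ℝ := fun x => ∏ i, w (x i)
  have hW : ∀ p, W (e p).1 * W (e p).2 = W p.1 * W p.2 := by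
    rintro ⟨x, y⟩
    simp only [W, he, ← Finset.prod_mul_distrib]
    refine Finset.prod_congr rfl fun i _ => ?_
    by_cases hi : i ∈ A <;> simp [hi, mul_comm]
  have hfe : ∀ p, f (e p).1 = f p.1 := by
    rintro ⟨x, y⟩
    refine hf fun i hi => ?_
    simp [he, Finset.mem_coe.1 hi]
  have hge : ∀ p, g (e p).1 = g p.2 := by
    rintro ⟨x, y⟩
    refine hg fun i hi => ?_
    simp [he, Finset.disjoint_right.1 hAB (Finset.mem_coe.1 hi)]
  calc iidMean w (fun x => f x * g x)
      = ∑ x, ∑ y, (W x * W y) • (f x * g x) := by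
        refine Finset.sum_congr rfl fun x _ => ?_
        rw [← Finset.sum_smul, ← Finset.mul_sum, sum_prod_weight hw, mul_one]
    _ = ∑ p : (ι → S) × (ι → S), (W p.1 * W p.2) • (f p.1 * g p.1) := by
        rw [Fintype.sum_prod_type]
    _ = ∑ p : (ι → S) × (ι → S), (W p.1 * W p.2) • (f p.1 * g p.2) := by
        rw [← Equiv.sum_comp e]
        refine Finset.sum_congr rfl fun p _ => ?_
        rw [hW, hfe, hge]
    _ = iidMean w f * iidMean w g := by
        rw [Fintype.sum_prod_type, iidMean, iidMean, Finset.sum_mul_sum]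
        refine Finset.sum_congr rfl fun x _ => Finset.sum_congr rfl fun y _ => ?_
        rw [smul_mul_smul_comm]

theorem iidMean_prod_of_disjoint {κ R : Type*} [DecidableEq κ] [CommRing R] [Algebra ℝ R]
    {w : S → ℝ} (hw : ∑ s, w s = 1) {f : κ → (ι → S) → R} {N : κ → Finset ι}
    (hf : ∀ k, DependsOn (f k) (N k : Set ι)) (c : Finset κ)
    (hc : (c : Set κ).PairwiseDisjoint N) :
    iidMean w (fun x => ∏ k ∈ c, f k x) = ∏ k ∈ c, iidMean w (f k) := by
  induction c using Finset.induction_on with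
  | empty => simp [iidMean_const hw]
  | insert a c ha ih =>
    rw [Finset.prod_insert ha, ← ih (hc.subset (by simp))]
    simp only [Finset.prod_insert ha]
    refine iidMean_mul_of_disjoint hw (hf a) (dependsOn_prod c hf) ?_
    rw [Finset.disjoint_biUnion_right]
    intro k hk
    exact hc (by simp) (by simp [hk]) (fun h => ha (h ▸ hk))

/-- The product of one-coordinate functions. -/
theorem iidMean_prod_eval {w : S → ℝ} (hw : ∑ s, w s = 1) (h : ι → S → ℝ) (c : Finset ι) :
    iidMean w (fun x : ι → S => ∏ i ∈ c, h i (x i)) = ∏ i ∈ c, ∑ s, w s * h i s := by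
  have key : ∀ h : ι → S → ℝ, iidMean w (fun x : ι → S => ∏ i, h i (x i))
      = ∏ i, ∑ s, w s * h i s := by
    intro h
    rw [Finset.prod_univ_sum, Fintype.piFinset_univ]
    simp [iidMean, Finset.prod_mul_distrib]
  have := key (fun i s => if i ∈ c then h i s else 1)
  convert this using 1
  · congr 1; ext x
    rw [Finset.prod_ite_mem, Finset.univ_inter]
  · rw [← Finset.prod_subset (Finset.subset_univ c)]
    · exact Finset.prod_congr rfl fun i hi => by simp [hi]
    · intro i _ hi
      simp [hi, hw]

/-- Since $e^z\le1+z+z^2$ for $|z|\le1$ and the linear term has mean zero, only the second moment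
enters; then $1+z\le e^z$. -/
theorem iidMean_exp_le {w : S → ℝ} (hw : ∑ s, w s = 1) (hw0 : ∀ s, 0 ≤ w s)
    {Y : (ι → S) → ℝ} {μ v : ℝ} (hμ : ∀ x, |μ * Y x| ≤ 1) (hY : iidMean w Y = 0)
    (hv : iidMean w (fun x => Y x ^ 2) ≤ v) :
    iidMean w (fun x => Real.exp (μ * Y x)) ≤ Real.exp (μ ^ 2 * v) := by
  calc iidMean w (fun x => Real.exp (μ * Y x))
      ≤ iidMean w (fun x => (1 + μ * Y x) + μ ^ 2 * Y x ^ 2) := by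
        refine iidMean_mono hw0 fun x => ?_
        have := (abs_le.1 (Real.abs_exp_sub_one_sub_id_le (hμ x))).2
        nlinarith
    _ = 1 + μ ^ 2 * iidMean w (fun x => Y x ^ 2) := by
        rw [iidMean_add, iidMean_add, iidMean_const hw, iidMean_const_mul, iidMean_const_mul, hY]
        ring
    _ ≤ 1 + μ ^ 2 * v := by gcongr
    _ ≤ _ := by linarith [Real.add_one_le_exp (μ ^ 2 * v)]

/-- A Bernstein type bound for sums of locally dependent variables: the index set is coloured so
that variables of the same colour are independent. -/
theorem iidMean_exp_sum_le {κ γ : Type*} [Fintype κ] [DecidableEq κ] [Fintype γ] [DecidableEq γ]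
    [Nonempty γ]
    {w : S → ℝ} (hw : ∑ s, w s = 1) (hw0 : ∀ s, 0 ≤ w s) {Y : κ → (ι → S) → ℝ} {N : κ → Finset ι}
    (hN : ∀ k, DependsOn (Y k) (N k : Set ι)) (color : κ → γ)
    (hcolor : ∀ k k', k ≠ k' → color k = color k' → Disjoint (N k) (N k'))
    {b v : ℝ} (lam : ℝ) (hb : ∀ k x, |Y k x| ≤ b) (hlam : Fintype.card γ * |lam| * b ≤ 1)
    (hv0 : 0 ≤ v)
    (hY : ∀ k, iidMean w (Y k) = 0) (hv : ∀ k, iidMean w (fun x => Y k x ^ 2) ≤ v) :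
    iidMean w (fun x => Real.exp (lam * ∑ k, Y k x))
      ≤ Real.exp ((Fintype.card γ * lam) ^ 2 * (Fintype.card κ * v)) := by
  set q : ℝ := (Fintype.card γ : ℝ) with hq
  have hq0 : 0 < q := by rw [hq]; exact_mod_cast Fintype.card_pos
  -- The full sum is the average of `q` times the colour class sums, so convexity of exp reduces the
  -- bound to single classes, whose terms are independent.
  have hpt : ∀ x, Real.exp (lam * ∑ k, Y k x)
      ≤ ∑ c : γ, q⁻¹ * Real.exp (∑ k with color k = c, q * lam * Y k x) := by
    intro x
    have h1 : lam * ∑ k, Y k x = ∑ c : γ, q⁻¹ • (∑ k with color k = c, q * lam * Y k x) := by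
      rw [← Finset.smul_sum, Finset.sum_fiberwise, ← Finset.mul_sum, smul_eq_mul]
      field_simp
    rw [h1]
    have := convexOn_exp.map_sum_le (t := Finset.univ) (w := fun _ : γ => q⁻¹)
      (p := fun c => ∑ k with color k = c, q * lam * Y k x)
      (fun _ _ => by positivity) (by simp [hq]) (fun _ _ => Set.mem_univ _)
    simpa using this
  have hclass : ∀ c : γ, iidMean w (fun x => Real.exp (∑ k with color k = c, q * lam * Y k x))
      ≤ Real.exp ((q * lam) ^ 2 * (Fintype.card κ * v)) := by
    intro c
    simp only [Real.exp_sum]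
    rw [iidMean_prod_of_disjoint hw (f := fun k x => Real.exp (q * lam * Y k x)) (N := N)]
    · calc ∏ k with color k = c, iidMean w (fun x => Real.exp (q * lam * Y k x))
          ≤ ∏ k with color k = c, Real.exp ((q * lam) ^ 2 * v) := by
            refine Finset.prod_le_prod
              (fun k _ => iidMean_nonneg hw0 fun x => (Real.exp_pos _).le) fun k _ => ?_
            refine iidMean_exp_le hw hw0 (fun x => ?_) (hY k) (hv k)
            rw [abs_mul, abs_mul, abs_of_pos hq0]
            exact (mul_le_mul_of_nonneg_left (hb k x) (by positivity)).trans hlam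
        _ = Real.exp (((Finset.univ.filter fun k => color k = c).card : ℝ)
              * ((q * lam) ^ 2 * v)) := by
            rw [Finset.prod_const, Real.exp_nat_mul]
        _ ≤ _ := by
            rw [Real.exp_le_exp]
            have : ((Finset.univ.filter fun k => color k = c).card : ℝ) ≤ Fintype.card κ := by
              exact_mod_cast Finset.card_filter_le _ _
            calc _ ≤ (Fintype.card κ : ℝ) * ((q * lam) ^ 2 * v) := by gcongr
              _ = _ := by ring
    · intro k x y h
      simp only
      rw [hN k h]
    · intro k hk k' hk' hkk'
      simp only [Finset.coe_filter, Finset.mem_univ, true_and, Set.mem_ofPred_eq] at hk hk'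
      exact hcolor k k' hkk' (hk.trans hk'.symm)
  calc iidMean w (fun x => Real.exp (lam * ∑ k, Y k x))
      ≤ iidMean w (fun x => ∑ c : γ, q⁻¹ * Real.exp (∑ k with color k = c, q * lam * Y k x)) :=
        iidMean_mono hw0 hpt
    _ = ∑ c : γ, q⁻¹ * iidMean w (fun x => Real.exp (∑ k with color k = c, q * lam * Y k x)) := by
        rw [iidMean_sum]
        exact Finset.sum_congr rfl fun c _ => iidMean_const_mul _ _ _
    _ ≤ ∑ c : γ, q⁻¹ * Real.exp ((q * lam) ^ 2 * (Fintype.card κ * v)) := by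
        gcongr with c _
        exact hclass c
    _ = _ := by
        rw [Finset.sum_const, Finset.card_univ, nsmul_eq_mul, ← hq]
        field_simp

end IidMean

/-! ### Cyclic windows -/

/-- The `ℓ` cyclically consecutive places that start with `k`. -/
def window (ℓ : ℕ) {n : ℕ} (k : Fin n) : Finset (Fin n) :=
  Finset.univ.image fun j : Fin ℓ => cyc k j

theorem cyc_mem_window {ℓ n : ℕ} (k : Fin n) (j : Fin ℓ) : cyc k j ∈ window ℓ k :=
  Finset.mem_image_of_mem _ (Finset.mem_univ j)

theorem dependsOn_window {ℓ n : ℕ} {S R : Type*} (φ : (Fin ℓ → S) → R) (k : Fin n) :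
    DependsOn (fun x : Fin n → S => φ fun j => x (cyc k j)) (window ℓ k : Set (Fin n)) := by
  intro x y h
  simp only
  congr 1
  ext j
  exact h _ (Finset.mem_coe.2 (cyc_mem_window k j))

theorem cyc_injective {ℓ n : ℕ} (hn : ℓ ≤ n) (k : Fin n) :
    Function.Injective fun j : Fin ℓ => cyc k j := by
  intro a b h
  have h1 : ((k : ℕ) + a) % n = ((k : ℕ) + b) % n := congrArg Fin.val h
  have h2 : (a : ℕ) % n = (b : ℕ) % n := Nat.ModEq.add_left_cancel' k h1
  rw [Nat.mod_eq_of_lt (a.isLt.trans_le hn), Nat.mod_eq_of_lt (b.isLt.trans_le hn)] at h2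
  exact Fin.ext h2

/-- A colouring of the places with `2 ℓ` colours, such that the windows that start at two places
of the same colour are disjoint. -/
def windowColor (ℓ : ℕ) (hℓ : 0 < ℓ) {n : ℕ} (k : Fin n) : Fin (2 * ℓ) :=
  -- Residues modulo `ℓ` separate windows except near the cyclic seam. The fewer than `ℓ` places
  -- left after the last complete block therefore get a colour each.
  if h : (k : ℕ) < ℓ * (n / ℓ) then ⟨k % ℓ, by have := Nat.mod_lt (k : ℕ) hℓ; omega⟩
  else ⟨ℓ + (k - ℓ * (n / ℓ)), by
    have := Nat.mod_lt n hℓ; have := Nat.div_add_mod n ℓ; have := k.isLt; omega⟩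

/-- Equal residues $r$ put $k$ and $k'$ at least $\ell$ apart, so the window of $k$ ends before
$k'$. If the window of $k'$ wraps around, it only reaches places below $r\le k$. -/
theorem cyc_ne_of_lt {ℓ n : ℕ} {k k' : Fin n} (hlt : k < k') (hk' : (k' : ℕ) < ℓ * (n / ℓ))
    (hmod : (k : ℕ) % ℓ = k' % ℓ) {a b : ℕ} (ha : a < ℓ) (hb : b < ℓ) : cyc k a ≠ cyc k' b := by
  intro h
  have h1 : ((k : ℕ) + a) % n = ((k' : ℕ) + b) % n := congrArg Fin.val h
  have hlt' : (k : ℕ) < k' := hlt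
  have hn : ℓ * (n / ℓ) ≤ n := Nat.mul_div_le n ℓ
  have e1 := Nat.div_add_mod (k : ℕ) ℓ
  have e2 := Nat.div_add_mod (k' : ℕ) ℓ
  have hd : (k : ℕ) / ℓ + 1 ≤ k' / ℓ := by
    by_contra hcon
    have : (k' : ℕ) / ℓ ≤ k / ℓ := by omega
    have := Nat.mul_le_mul_left ℓ this
    omega
  have hq : (k' : ℕ) / ℓ + 1 ≤ n / ℓ := Nat.div_lt_of_lt_mul hk'
  have m1 := Nat.mul_le_mul_left ℓ hd
  have m2 := Nat.mul_le_mul_left ℓ hq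
  rw [Nat.mul_add] at m1 m2
  have hr := Nat.mod_lt (k : ℕ) (lt_of_le_of_lt (Nat.zero_le a) ha)
  rw [Nat.mod_eq_of_lt (show (k : ℕ) + a < n by have := k'.isLt; omega)] at h1
  rcases lt_or_ge ((k' : ℕ) + b) n with h2 | h2
  · rw [Nat.mod_eq_of_lt h2] at h1
    omega
  · rw [Nat.mod_eq_sub_mod h2, Nat.mod_eq_of_lt (by have := k'.isLt; omega)] at h1
    omega

theorem window_disjoint {ℓ : ℕ} (hℓ : 0 < ℓ) {n : ℕ} (k k' : Fin n) (hne : k ≠ k')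
    (hcol : windowColor ℓ hℓ k = windowColor ℓ hℓ k') :
    Disjoint (window ℓ k) (window ℓ k') := by
  have hv := congrArg Fin.val hcol
  have hr := Nat.mod_lt (k : ℕ) hℓ
  have hr' := Nat.mod_lt (k' : ℕ) hℓ
  have hne' : (k : ℕ) ≠ k' := fun h => hne (Fin.ext h)
  unfold windowColor at hv
  rw [Finset.disjoint_left]
  intro i hi hi'
  obtain ⟨a, _, rfl⟩ := Finset.mem_image.1 hi
  obtain ⟨b, _, hb⟩ := Finset.mem_image.1 hi'
  split_ifs at hv with h1 h2 h2 <;> simp only at hv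
  · rcases lt_or_gt_of_ne hne with h | h
    · exact cyc_ne_of_lt h h2 hv a.isLt b.isLt hb.symm
    · exact cyc_ne_of_lt h h1 hv.symm b.isLt a.isLt hb
  all_goals omega

section

variable {S : Type*} [Fintype S] {w : S → ℝ}

/-- Exponential moments of a centered local functional of a cyclic i.i.d. sequence. -/
theorem iidMean_exp_window_sum_le {ℓ n : ℕ} (hℓ : 0 < ℓ) (hw : ∑ s, w s = 1)
    (hw0 : ∀ s, 0 ≤ w s) (φ : (Fin ℓ → S) → ℝ) {b v : ℝ} (lam : ℝ) (hb : ∀ y, |φ y| ≤ b)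
    (hlam : 2 * ℓ * |lam| * b ≤ 1) (hv0 : 0 ≤ v)
    (hφ : ∀ k : Fin n, iidMean w (fun x => φ fun j => x (cyc k j)) = 0)
    (hv : ∀ k : Fin n, iidMean w (fun x => (φ fun j => x (cyc k j)) ^ 2) ≤ v) :
    iidMean w (fun x => Real.exp (lam * ∑ k : Fin n, φ fun j => x (cyc k j)))
      ≤ Real.exp ((2 * ℓ * lam) ^ 2 * (n * v)) := by
  have : Nonempty (Fin (2 * ℓ)) := ⟨⟨0, by omega⟩⟩
  have := iidMean_exp_sum_le (κ := Fin n) hw hw0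
    (Y := fun k x => φ fun j => x (cyc k j)) (N := window ℓ) (dependsOn_window φ)
    (windowColor ℓ hℓ) (window_disjoint hℓ) lam (fun k x => hb _) (by simpa using hlam) hv0 hφ hv
  simpa using this

/-- In the expansion of `ψ` into products of centered variables, every nonempty product has mean
zero, because the places of a window are distinct when `ℓ ≤ n`. The map `β` allows a three-state
sequence to be read as a 0/1 sequence at either of two times. -/
theorem iidMean_window {ℓ n : ℕ} (hn : ℓ ≤ n) (hw : ∑ s, w s = 1) (ψ : (Fin ℓ → Bool) → ℝ)
    (β : S → Bool) {t : ℝ} (ht : ∑ s, w s * bit (β s) = t) (k : Fin n) :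
    iidMean w (fun x => ψ fun j => β (x (cyc k j))) = meanProfile ψ t := by
  have hcenter : ∑ s, w s * (bit (β s) - t) = 0 := by
    simp only [mul_sub, Finset.sum_sub_distrib, ht, ← Finset.sum_mul, hw]
    ring
  simp only [window_expansion ψ t]
  rw [iidMean_sum, Finset.sum_eq_single ∅]
  · rw [iidMean_const_mul]
    simp [iidMean_const hw, coeff_empty]
  · intro B _ hB
    have : ∀ x : Fin n → S, ∏ j ∈ B, (bit (β (x (cyc k j))) - t)
        = ∏ i ∈ B.image (fun j : Fin ℓ => cyc k j), (bit (β (x i)) - t) := fun x =>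
      (Finset.prod_image (f := fun i => bit (β (x i)) - t)
        fun a _ b _ h => cyc_injective hn k h).symm
    rw [iidMean_const_mul]
    simp only [this]
    rw [iidMean_prod_eval hw (fun _ s => bit (β s) - t)]
    simp only [hcenter]
    rw [Finset.prod_const, zero_pow, mul_zero]
    rw [Finset.card_ne_zero]
    exact (Finset.nonempty_iff_ne_empty.2 hB).image _
  · simp

theorem iidMean_ite_eq [DecidableEq S] {ι : Type*} [Fintype ι] [DecidableEq ι]
    (hw : ∑ s, w s = 1) (i : ι) (s : S) :
    iidMean w (fun x : ι → S => if x i = s then (1 : ℝ) else 0) = w s := by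
  have := iidMean_prod_eval hw (fun _ s' => if s' = s then (1 : ℝ) else 0) {i}
  simpa using this

theorem iidMean_sq_sub_le {ι : Type*} [Fintype ι] [DecidableEq ι] (hw : ∑ s, w s = 1)
    {f : (ι → S) → ℝ} {c : ℝ} (hc : iidMean w f = c) :
    iidMean w (fun x => (f x - c) ^ 2) ≤ iidMean w (fun x => f x ^ 2) := by
  have : ∀ x, (f x - c) ^ 2 = (f x ^ 2 - (2 * c) * f x) + c ^ 2 := fun x => by ring
  simp only [this]
  rw [iidMean_add, iidMean_sub, iidMean_const_mul, iidMean_const hw, hc]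
  nlinarith [sq_nonneg c]

end

/-! ### Two times: every item is early, middle or late -/

/-- The probabilities that an item is early, middle or late. -/
def trinomialWeight (s t : ℝ) : Fin 3 → ℝ := ![s, t - s, 1 - t]

theorem sum_trinomialWeight (s t : ℝ) : ∑ i, trinomialWeight s t i = 1 := by
  simp [trinomialWeight, Fin.sum_univ_three]

theorem trinomialWeight_nonneg {s t : ℝ} (hs : 0 ≤ s) (hst : s ≤ t) (ht : t ≤ 1) (i : Fin 3) :
    0 ≤ trinomialWeight s t i := by
  fin_cases i <;> simp [trinomialWeight, *]

/-- The centered increment of the local functional between two times. -/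
def increment {ℓ : ℕ} (ψ : (Fin ℓ → Bool) → ℝ) (s t : ℝ) {n : ℕ} (x : Fin n → Fin 3) : ℝ :=
  localSum ψ (fun k => decide (x k ≠ 2)) - localSum ψ (fun k => decide (x k = 0))
    - n * (meanProfile ψ t - meanProfile ψ s)

/-- A window contributes to the uncentered increment only if it contains a middle item, which has
probability at most $\ell(t-s)$. The resulting factor $t-s$ in the variance is what makes short time
intervals have small fluctuations. -/
theorem iidMean_exp_increment_le {ℓ n : ℕ} (hℓ : 0 < ℓ) (hn : ℓ ≤ n) (ψ : (Fin ℓ → Bool) → ℝ)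
    {K : ℝ} (hK : ∀ y, |ψ y| ≤ K) {s t : ℝ} (hs : 0 ≤ s) (hst : s ≤ t) (ht : t ≤ 1) (lam : ℝ)
    (hlam : 2 * ℓ * |lam| * (4 * K) ≤ 1) :
    iidMean (trinomialWeight s t) (fun x : Fin n → Fin 3 => Real.exp (lam * increment ψ s t x))
      ≤ Real.exp ((2 * ℓ * lam) ^ 2 * (n * (4 * K ^ 2 * ℓ * (t - s)))) := by
  have hw := sum_trinomialWeight s t
  have hw0 := trinomialWeight_nonneg hs hst ht
  have hK0 : 0 ≤ K := (abs_nonneg _).trans (hK fun _ => true)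
  set φ₀ : (Fin ℓ → Fin 3) → ℝ := fun y =>
    ψ (fun j => decide (y j ≠ 2)) - ψ (fun j => decide (y j = 0)) with hφ₀
  have hm : ∀ k : Fin n, iidMean (trinomialWeight s t) (fun x => φ₀ fun j => x (cyc k j))
      = meanProfile ψ t - meanProfile ψ s := by
    intro k
    simp only [hφ₀]
    rw [iidMean_sub, iidMean_window hn hw ψ (fun i => decide (i ≠ 2)) (t := t),
      iidMean_window hn hw ψ (fun i => decide (i = 0)) (t := s)]
    · simp [trinomialWeight, bit]
    · simp [trinomialWeight, Fin.sum_univ_three, bit]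
  have hφ₀K : ∀ y, |φ₀ y| ≤ 2 * K := fun y => by
    refine (abs_sub _ _).trans ?_
    linarith [hK fun j => decide (y j ≠ 2), hK fun j => decide (y j = 0)]
  have hn0 : 0 < n := hℓ.trans_le hn
  have hg : |meanProfile ψ t - meanProfile ψ s| ≤ 2 * K := by
    rw [← hm ⟨0, hn0⟩, ← Real.norm_eq_abs]
    refine (norm_iidMean_le hw0 _).trans ((iidMean_mono hw0 fun x => ?_).trans_eq
      (iidMean_const hw (2 * K)))
    exact hφ₀K _
  have hinc : ∀ x : Fin n → Fin 3, increment ψ s t x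
      = ∑ k : Fin n, ((φ₀ fun j => x (cyc k j)) - (meanProfile ψ t - meanProfile ψ s)) := by
    intro x
    simp only [increment, localSum, hφ₀, Finset.sum_sub_distrib, Finset.sum_const,
      Finset.card_univ, Fintype.card_fin, nsmul_eq_mul]
    ring
  simp only [hinc]
  refine iidMean_exp_window_sum_le hℓ hw hw0
    (fun y => φ₀ y - (meanProfile ψ t - meanProfile ψ s)) lam (b := 4 * K) (fun y => ?_) hlam
    (by have := sub_nonneg.2 hst; positivity) (fun k => ?_) (fun k => ?_)
  · refine (abs_sub _ _).trans ?_
    linarith [hφ₀K y, hg]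
  · rw [iidMean_sub, hm, iidMean_const hw, sub_self]
  · refine (iidMean_sq_sub_le hw (hm k)).trans ?_
    -- The number of middle items in the window dominates the indicator that there is one.
    have hpt : ∀ x : Fin n → Fin 3, (φ₀ fun j => x (cyc k j)) ^ 2
        ≤ (2 * K) ^ 2 * ∑ j : Fin ℓ, if x (cyc k j) = 1 then (1 : ℝ) else 0 := by
      intro x
      by_cases h : ∃ j : Fin ℓ, x (cyc k j) = 1
      · obtain ⟨j, hj⟩ := h
        have h1 : (1 : ℝ) ≤ ∑ j : Fin ℓ, if x (cyc k j) = 1 then (1 : ℝ) else 0 := by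
          refine le_trans ?_ (Finset.single_le_sum (fun j _ => ?_) (Finset.mem_univ j))
          · simp [hj]
          · split_ifs <;> norm_num
        have h2 := sq_le_sq' (abs_le.1 (hφ₀K fun j => x (cyc k j))).1
          (abs_le.1 (hφ₀K fun j => x (cyc k j))).2
        nlinarith [sq_nonneg (2 * K)]
      · push Not at h
        have : (φ₀ fun j => x (cyc k j)) = 0 := by
          simp only [hφ₀, sub_eq_zero]
          congr 1
          ext j
          have key : ∀ i : Fin 3, i ≠ 1 → decide (i ≠ 2) = decide (i = 0) := by decide
          exact key _ (h j)
        rw [this]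
        simp [h]
    refine (iidMean_mono hw0 hpt).trans ?_
    rw [iidMean_const_mul, iidMean_sum]
    simp only [iidMean_ite_eq hw]
    simp [trinomialWeight]
    apply le_of_eq; ring

/-! ### Averages over permutations -/

/-- The average over all permutations. -/
def permMean {ι : Type*} [Fintype ι] [DecidableEq ι] {E : Type*} [AddCommGroup E] [Module ℝ E]
    (f : Equiv.Perm ι → E) : E :=
  ((Fintype.card (Equiv.Perm ι) : ℝ)⁻¹) • ∑ τ, f τ

theorem integral_permMeasure {E : Type*} [NormedAddCommGroup E] [NormedSpace ℝ E]
    [CompleteSpace E] {n : ℕ} (f : Equiv.Perm (Fin n) → E) :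
    ∫ τ, f τ ∂permMeasure n = permMean f := by
  have : MeasurableSingletonClass (Equiv.Perm (Fin n)) := ⟨fun _ => trivial⟩
  rw [permMeasure, PMF.integral_eq_sum, permMean, Finset.smul_sum]
  simp [PMF.uniformOfFintype_apply]

section PermMean

variable {ι : Type*} [Fintype ι] [DecidableEq ι]

theorem permMean_mono {f g : Equiv.Perm ι → ℝ} (h : ∀ τ, f τ ≤ g τ) : permMean f ≤ permMean g :=
  smul_le_smul_of_nonneg_left (Finset.sum_le_sum fun τ _ => h τ) (by positivity)

theorem permMean_nonneg {f : Equiv.Perm ι → ℝ} (h : ∀ τ, 0 ≤ f τ) : 0 ≤ permMean f :=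
  smul_nonneg (by positivity) (Finset.sum_nonneg fun τ _ => h τ)

theorem norm_permMean_le {E : Type*} [NormedAddCommGroup E] [NormedSpace ℝ E]
    (f : Equiv.Perm ι → E) : ‖permMean f‖ ≤ permMean (fun τ => ‖f τ‖) := by
  rw [permMean, permMean, norm_smul, Real.norm_of_nonneg (by positivity), smul_eq_mul]
  gcongr
  exact norm_sum_le _ _

section Module

variable {E : Type*} [AddCommGroup E] [Module ℝ E]

theorem permMean_add (f g : Equiv.Perm ι → E) :
    permMean (fun τ => f τ + g τ) = permMean f + permMean g := by
  simp [permMean, Finset.sum_add_distrib]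

theorem permMean_sub (f g : Equiv.Perm ι → E) :
    permMean (fun τ => f τ - g τ) = permMean f - permMean g := by
  simp [permMean, Finset.sum_sub_distrib, smul_sub]

theorem permMean_sum {κ : Type*} (s : Finset κ) (f : κ → Equiv.Perm ι → E) :
    permMean (fun τ => ∑ k ∈ s, f k τ) = ∑ k ∈ s, permMean (f k) := by
  simp only [permMean, ← Finset.smul_sum]
  rw [Finset.sum_comm]

theorem permMean_const (c : E) : permMean (fun _ : Equiv.Perm ι => c) = c := by
  rw [permMean, Finset.sum_const, Finset.card_univ, ← Nat.cast_smul_eq_nsmul ℝ, smul_smul,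
    inv_mul_cancel₀ (Nat.cast_ne_zero.2 Fintype.card_ne_zero), one_smul]

theorem permMean_inv (f : Equiv.Perm ι → E) : permMean (fun τ => f τ⁻¹) = permMean f := by
  rw [permMean, permMean, ← Equiv.sum_comp (Equiv.inv (Equiv.Perm ι)) f]
  rfl

theorem permMean_mul_left (σ : Equiv.Perm ι) (f : Equiv.Perm ι → E) :
    permMean (fun τ => f (σ * τ)) = permMean f := by
  rw [permMean, permMean, ← Equiv.sum_comp (Equiv.mulLeft σ) f]
  rfl

theorem iidMean_permMean {S : Type*} [Fintype S] (w : S → ℝ) (f : (ι → S) → E) :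
    iidMean w (fun x => permMean fun σ => f (x ∘ σ)) = iidMean w f := by
  have h1 : iidMean w (fun x => permMean fun σ : Equiv.Perm ι => f (x ∘ σ))
      = permMean (fun σ : Equiv.Perm ι => iidMean w (fun x => f (x ∘ σ))) := by
    simp only [iidMean, permMean, Finset.smul_sum]
    rw [Finset.sum_comm]
    exact Finset.sum_congr rfl fun σ _ => Finset.sum_congr rfl fun x _ => smul_comm _ _ _
  rw [h1]
  simp only [iidMean_comp_perm]
  exact permMean_const _

end Module

theorem permMean_const_mul (c : ℝ) (f : Equiv.Perm ι → ℝ) :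
    permMean (fun τ => c * f τ) = c * permMean f := by
  simp only [permMean, ← Finset.mul_sum, smul_eq_mul]
  ring

end PermMean

/-! ### Conditioning an i.i.d. sequence on its counts -/

/-- These permutations form a coset of the stabilizer of `c`, which is a product of the symmetric
groups of the fibres. -/
theorem card_comp_perm_eq {ι S : Type*} [Fintype ι] [DecidableEq ι] [Fintype S] [DecidableEq S]
    (c : ι → S) (σ₀ : Equiv.Perm ι) :
    (Finset.univ.filter fun σ : Equiv.Perm ι => c ∘ σ = c ∘ σ₀).card
      = ∏ s, (Finset.univ.filter fun i => c i = s).card.factorial := by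
  have h := DomMulAct.stabilizer_card c
  simp only [Fintype.card_subtype] at h
  rw [← h]
  refine Finset.card_bij (fun σ _ => σ * σ₀⁻¹) ?_ ?_ ?_
  · intro σ hσ
    simp only [Finset.mem_filter, Finset.mem_univ, true_and] at hσ ⊢
    rw [Equiv.Perm.coe_mul, ← Function.comp_assoc, hσ]
    ext i; simp
  · intro σ _ σ' _ h
    exact mul_right_cancel h
  · intro g hg
    simp only [Finset.mem_filter, Finset.mem_univ, true_and] at hg
    refine ⟨g * σ₀, ?_, by simp⟩
    simp only [Finset.mem_filter, Finset.mem_univ, true_and]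
    rw [Equiv.Perm.coe_mul, ← Function.comp_assoc, hg]

/-- A uniform rearrangement of `c` is the i.i.d. sequence conditioned to have the counts of `c`, an
event of probability $n!\prod_iw(c_i)/\prod_sn_s!$. As $F\ge0$, restricting the i.i.d. mean to this
event can only decrease it; denominators are cleared. -/
theorem permMean_comp_le {ι S : Type*} [Fintype ι] [DecidableEq ι] [Fintype S] [DecidableEq S]
    {w : S → ℝ} (hw0 : ∀ s, 0 ≤ w s) (c : ι → S) {F : (ι → S) → ℝ} (hF : ∀ x, 0 ≤ F x) :
    ((Fintype.card ι).factorial : ℝ) * (∏ i, w (c i)) * permMean (fun σ => F (c ∘ σ))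
      ≤ (∏ s, ((Finset.univ.filter fun i => c i = s).card.factorial : ℝ)) * iidMean w F := by
  have h1 : ((Fintype.card ι).factorial : ℝ) * (∏ i, w (c i)) * permMean (fun σ => F (c ∘ σ))
      = ∑ x : ι → S, (∏ i, w (c i)) *
          ((Finset.univ.filter fun σ : Equiv.Perm ι => c ∘ σ = x).card * F x) := by
    rw [← Finset.mul_sum]
    have : ∑ x : ι → S, ((Finset.univ.filter fun σ : Equiv.Perm ι => c ∘ σ = x).card * F x)
        = ∑ σ : Equiv.Perm ι, F (c ∘ σ) := by
      rw [← Finset.sum_fiberwise Finset.univ (fun σ : Equiv.Perm ι => c ∘ σ)]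
      refine Finset.sum_congr rfl fun x _ => ?_
      rw [Finset.sum_congr rfl (g := fun _ => F x), Finset.sum_const, nsmul_eq_mul]
      intro σ hσ
      rw [(Finset.mem_filter.1 hσ).2]
    rw [this, permMean, Fintype.card_perm, smul_eq_mul]
    have : ((Fintype.card ι).factorial : ℝ) ≠ 0 := by positivity
    field_simp
  rw [h1, iidMean, Finset.mul_sum]
  refine Finset.sum_le_sum fun x _ => ?_
  rcases (Finset.univ.filter fun σ : Equiv.Perm ι => c ∘ σ = x).eq_empty_or_nonempty with h | h
  · rw [h, Finset.card_empty, Nat.cast_zero, zero_mul, mul_zero]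
    exact mul_nonneg (by positivity)
      (smul_nonneg (Finset.prod_nonneg fun _ _ => hw0 _) (hF x))
  · obtain ⟨σ₀, hσ₀⟩ := h
    obtain rfl := (Finset.mem_filter.1 hσ₀).2
    rw [card_comp_perm_eq c σ₀]
    have : ∏ i, w ((c ∘ σ₀) i) = ∏ i, w (c i) := Equiv.prod_comp σ₀ fun i => w (c i)
    rw [this, smul_eq_mul]
    push_cast
    apply le_of_eq; ring

/-! ### Lower bounds for binomial and trinomial weights at the mean -/

/-- The Poisson terms $a^j/j!$ are largest at $j=a$. -/
theorem pow_mul_factorial_le (a j : ℕ) : a ^ j * a.factorial ≤ a ^ a * j.factorial := by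
  rcases le_total a j with h | h
  · have := Nat.mul_le_mul_left (a ^ a) (Nat.factorial_mul_pow_sub_le_factorial h)
    calc a ^ j * a.factorial = a ^ a * (a.factorial * a ^ (j - a)) := by
          rw [← Nat.sub_add_cancel h, pow_add, Nat.add_sub_cancel]; ring
      _ ≤ _ := this
  · have h1 := Nat.factorial_mul_descFactorial (Nat.sub_le a j)
    rw [Nat.sub_sub_self h] at h1
    have h2 := Nat.descFactorial_le_pow a (a - j)
    calc a ^ j * a.factorial = a ^ j * (j.factorial * a.descFactorial (a - j)) := by rw [h1]
      _ ≤ a ^ j * (j.factorial * a ^ (a - j)) := by gcongr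
      _ = (a ^ (a - j) * a ^ j) * j.factorial := by ring
      _ = a ^ a * j.factorial := by rw [← pow_add, Nat.sub_add_cancel h]

/-- A binomial distribution has at least the weight `1 / (n + 1)` at its mean, if this is an
integer. -/
theorem add_pow_mul_factorial_le (a b : ℕ) :
    (a + b) ^ (a + b) * (a.factorial * b.factorial)
      ≤ (a + b + 1) * ((a + b).factorial * (a ^ a * b ^ b)) := by
  rw [add_pow, Finset.sum_mul]
  refine (Finset.sum_le_card_nsmul _ _ ((a + b).factorial * (a ^ a * b ^ b)) fun j hj => ?_).trans
    (by simp)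
  have hj' : j ≤ a + b := Nat.lt_succ_iff.1 (Finset.mem_range.1 hj)
  rw [← Nat.choose_mul_factorial_mul_factorial hj']
  calc a ^ j * b ^ (a + b - j) * (a + b).choose j * (a.factorial * b.factorial)
      = (a + b).choose j * ((a ^ j * a.factorial) * (b ^ (a + b - j) * b.factorial)) := by ring
    _ ≤ (a + b).choose j * ((a ^ a * j.factorial) * (b ^ b * (a + b - j).factorial)) := by
        exact Nat.mul_le_mul_left _
          (Nat.mul_le_mul (pow_mul_factorial_le _ _) (pow_mul_factorial_le _ _))
    _ = _ := by ring

/-- A trinomial weight is a product of two binomial ones: `a` against `b + c`, then `b` against `c`.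
The bound for two cells is applied to each, and the common factor $(b+c)!\,(b+c)^{b+c}$ cancels. -/
theorem add_add_pow_mul_factorial_le (a b c : ℕ) :
    (a + b + c) ^ (a + b + c) * (a.factorial * b.factorial * c.factorial)
      ≤ (a + b + c + 1) ^ 2 * ((a + b + c).factorial * (a ^ a * b ^ b * c ^ c)) := by
  have h1 := add_pow_mul_factorial_le a (b + c)
  have h2 := add_pow_mul_factorial_le b c
  rw [← add_assoc] at h1
  have hpos : 0 < (b + c).factorial * (b + c) ^ (b + c) :=
    Nat.mul_pos (Nat.factorial_pos _) (by
      rcases Nat.eq_zero_or_pos (b + c) with h | h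
      · rw [h]; simp
      · positivity)
  refine Nat.le_of_mul_le_mul_left ?_ hpos
  calc (b + c).factorial * (b + c) ^ (b + c) *
        ((a + b + c) ^ (a + b + c) * (a.factorial * b.factorial * c.factorial))
      = ((a + b + c) ^ (a + b + c) * (a.factorial * (b + c).factorial)) *
        ((b + c) ^ (b + c) * (b.factorial * c.factorial)) := by ring
    _ ≤ ((a + b + c + 1) * ((a + b + c).factorial * (a ^ a * (b + c) ^ (b + c)))) *
        ((b + c + 1) * ((b + c).factorial * (b ^ b * c ^ c))) := Nat.mul_le_mul h1 h2
    _ ≤ ((a + b + c + 1) * ((a + b + c).factorial * (a ^ a * (b + c) ^ (b + c)))) *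
        ((a + b + c + 1) * ((b + c).factorial * (b ^ b * c ^ c))) := by
        gcongr; omega
    _ = _ := by ring

/-- The state of the item with place `i` in the input, at the times `m ≤ m'`. -/
def stage (m m' : ℕ) {n : ℕ} (i : Fin n) : Fin 3 :=
  if (i : ℕ) < m then 0 else if (i : ℕ) < m' then 1 else 2

theorem card_val_lt {n m : ℕ} (hm : m ≤ n) :
    (Finset.univ.filter fun i : Fin n => (i : ℕ) < m).card = m := by
  rw [Fin.card_filter_val_lt, min_eq_right hm]

theorem card_stage {n m m' : ℕ} (hm : m ≤ m') (hm' : m' ≤ n) :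
    (Finset.univ.filter fun i : Fin n => stage m m' i = 0).card = m ∧
    (Finset.univ.filter fun i : Fin n => stage m m' i = 1).card = m' - m ∧
    (Finset.univ.filter fun i : Fin n => stage m m' i = 2).card = n - m' := by
  have h0 : (Finset.univ.filter fun i : Fin n => stage m m' i = 0).card = m := by
    refine Eq.trans ?_ (card_val_lt (hm.trans hm'))
    congr 1; ext i
    simp only [Finset.mem_filter, Finset.mem_univ, true_and]
    unfold stage
    split_ifs <;> simp_all
  have h1 : (Finset.univ.filter fun i : Fin n => stage m m' i = 0).card
      + (Finset.univ.filter fun i : Fin n => stage m m' i = 1).card = m' := by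
    rw [← Finset.card_union_of_disjoint]
    · refine Eq.trans ?_ (card_val_lt hm')
      congr 1; ext i
      simp only [Finset.mem_union, Finset.mem_filter, Finset.mem_univ, true_and]
      unfold stage
      split_ifs <;> simp_all
      omega
    · rw [Finset.disjoint_filter]
      intro i _ h h'
      simp [h] at h'
  have h2 : (Finset.univ.filter fun i : Fin n => stage m m' i = 0).card
      + (Finset.univ.filter fun i : Fin n => stage m m' i = 1).card
      + (Finset.univ.filter fun i : Fin n => stage m m' i = 2).card = n := by
    have := Finset.card_eq_sum_card_fiberwise (s := (Finset.univ : Finset (Fin n)))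
      (t := (Finset.univ : Finset (Fin 3))) (f := stage m m') (fun _ _ => Finset.mem_univ _)
    rw [Fin.sum_univ_three] at this
    simpa using this.symm
  omega

/-- Conditioning on the counts costs at most a polynomial factor. -/
theorem permMean_stage_le {n m m' : ℕ} (hn : 0 < n) (hm : m ≤ m') (hm' : m' ≤ n)
    {F : (Fin n → Fin 3) → ℝ} (hF : ∀ x, 0 ≤ F x) :
    permMean (fun τ : Equiv.Perm (Fin n) => F (stage m m' ∘ τ.symm))
      ≤ ((n : ℝ) + 1) ^ 2 * iidMean (trinomialWeight (m / n) (m' / n)) F := by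
  have hn' : (0 : ℝ) < n := by exact_mod_cast hn
  have h1 : permMean (fun τ : Equiv.Perm (Fin n) => F (stage m m' ∘ τ.symm))
      = permMean (fun τ : Equiv.Perm (Fin n) => F (stage m m' ∘ τ)) :=
    permMean_inv (fun τ : Equiv.Perm (Fin n) => F (stage m m' ∘ τ))
  have hmle : (m : ℝ) ≤ m' := by exact_mod_cast hm
  have hmle' : (m' : ℝ) ≤ n := by exact_mod_cast hm'
  have hw0 : ∀ i, 0 ≤ trinomialWeight ((m : ℝ) / n) (m' / n) i :=
    trinomialWeight_nonneg (by positivity) (by gcongr) (by rwa [div_le_one hn'])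
  have h2 := permMean_comp_le hw0 (stage (n := n) m m') hF
  obtain ⟨c0, c1, c2⟩ := card_stage (n := n) hm hm'
  obtain ⟨a, rfl⟩ : ∃ a, a = m := ⟨_, rfl⟩
  obtain ⟨b, hb⟩ : ∃ b, b = m' - a := ⟨_, rfl⟩
  obtain ⟨c, hc⟩ : ∃ c, c = n - m' := ⟨_, rfl⟩
  have hnabc : a + b + c = n := by omega
  have hm'ab : m' = a + b := by omega
  have hprod : ∏ i, trinomialWeight ((a : ℝ) / n) (m' / n) (stage (n := n) a m' i)
      = ((a : ℝ) ^ a * b ^ b * c ^ c) / (n : ℝ) ^ n := by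
    rw [← Finset.prod_fiberwise' Finset.univ (stage (n := n) a m')
      (trinomialWeight ((a : ℝ) / n) (m' / n)), Fin.prod_univ_three]
    simp only [Finset.prod_const, c0, c1, c2, ← hb, ← hc]
    have e1 : trinomialWeight ((a : ℝ) / n) (m' / n) 0 = a / n := rfl
    have e2 : trinomialWeight ((a : ℝ) / n) (m' / n) 1 = b / n := by
      change (m' : ℝ) / n - a / n = b / n
      rw [hm'ab]; push_cast; ring
    have e3 : trinomialWeight ((a : ℝ) / n) (m' / n) 2 = c / n := by
      change 1 - (m' : ℝ) / n = c / n
      rw [eq_div_iff hn'.ne', sub_mul, div_mul_cancel₀ _ hn'.ne', hm'ab, ← hnabc]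
      push_cast; ring
    rw [e1, e2, e3, div_pow, div_pow, div_pow, div_mul_div_comm, div_mul_div_comm, ← pow_add,
      ← pow_add, hnabc]
  rw [hprod, Fin.prod_univ_three, c0, c1, c2, ← hb, ← hc, Fintype.card_fin] at h2
  rw [h1]
  set P := permMean fun τ : Equiv.Perm (Fin n) => F (stage a m' ∘ τ)
  set Q := iidMean (trinomialWeight ((a : ℝ) / n) (m' / n)) F
  have hP : 0 ≤ P := permMean_nonneg fun τ => hF _
  -- The weights equal the count frequencies, so the counts are exactly at the trinomial mean and
  -- have probability at least $(n+1)^{-2}$.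
  have h3 : (n : ℝ) ^ n * (a.factorial * b.factorial * c.factorial)
      ≤ (n + 1) ^ 2 * (n.factorial * (a ^ a * b ^ b * c ^ c)) := by
    have := add_add_pow_mul_factorial_le a b c
    rw [hnabc] at this
    exact_mod_cast this
  have hfac : (0 : ℝ) < a.factorial * b.factorial * c.factorial := by positivity
  have hnn : (0 : ℝ) < (n : ℝ) ^ n := by positivity
  rw [mul_div_assoc', div_mul_eq_mul_div, div_le_iff₀ hnn] at h2
  have h4 := mul_le_mul_of_nonneg_right h3 hP
  have h5 := mul_le_mul_of_nonneg_left h2 (show (0 : ℝ) ≤ ((n : ℝ) + 1) ^ 2 by positivity)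
  have h6 : ((n : ℝ) ^ n * (a.factorial * b.factorial * c.factorial)) * P
      ≤ ((n : ℝ) ^ n * (a.factorial * b.factorial * c.factorial)) * ((n + 1) ^ 2 * Q) := by
    calc _ ≤ _ := h4
      _ = ((n : ℝ) + 1) ^ 2 * (n.factorial * (a ^ a * b ^ b * c ^ c) * P) := by ring
      _ ≤ _ := h5
      _ = _ := by ring
  exact le_of_mul_le_mul_left h6 (by positivity)

/-- The number of 1's. -/
def onesCount {n : ℕ} (x : Fin n → Bool) : ℕ := (Finset.univ.filter fun i => x i = true).card

theorem onesCount_le {n : ℕ} (x : Fin n → Bool) : onesCount x ≤ n := by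
  simpa [onesCount] using Finset.card_filter_le (Finset.univ : Finset (Fin n)) (fun i => x i = true)

theorem exists_perm_comp_eq {n : ℕ} (x : Fin n → Bool) :
    ∃ σ : Equiv.Perm (Fin n), x = (fun i : Fin n => decide ((i : ℕ) < onesCount x)) ∘ σ := by
  have hcard : Fintype.card {i // x i = true}
      = Fintype.card {i : Fin n // (i : ℕ) < onesCount x} := by
    rw [Fintype.card_subtype, Fintype.card_subtype, card_val_lt (onesCount_le x)]
    rfl
  let e := Fintype.equivOfCardEq hcard
  refine ⟨e.extendSubtype, ?_⟩
  ext i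
  by_cases hi : x i = true
  · simp [hi, e.extendSubtype_mem i hi]
  · have := e.extendSubtype_not_mem i hi
    simp only [Function.comp_apply]
    rw [Bool.not_eq_true] at hi
    rw [hi, eq_comm, decide_eq_false_iff_not]
    exact this

/-- An i.i.d. 0/1 sequence has the same distribution as the sequence `I_{n,M}` of an independent
random permutation, when `M` is its number of 1's. -/
theorem iidMean_permMean_indicator {n : ℕ} {E : Type*} [AddCommGroup E] [Module ℝ E]
    (w : Bool → ℝ) (f : (Fin n → Bool) → E) :
    iidMean w (fun x : Fin n → Bool => permMean fun τ => f (indicator τ (onesCount x)))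
      = iidMean w f := by
  rw [← iidMean_permMean w f]
  congr 1
  ext x
  -- `x` is a rearrangement of the block of 1's followed by 0's, and the rearrangement is absorbed
  -- by the uniform permutation.
  obtain ⟨σ, hσ⟩ := exists_perm_comp_eq x
  conv_rhs => rw [hσ]
  rw [← permMean_inv, ← permMean_mul_left σ]
  congr 1

/-! ### The central limit theorem for locally dependent variables -/

theorem norm_exp_sub_one_sub_le (y : ℝ) :
    ‖Complex.exp (y * Complex.I) - 1 - y * Complex.I‖ ≤ 2 * y ^ 2 := by
  have hy : ‖(y : ℂ) * Complex.I‖ = |y| := by simp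
  rcases le_total |y| 1 with h | h
  · refine (Complex.norm_exp_sub_one_sub_id_le (by rwa [hy])).trans ?_
    rw [hy, sq_abs]
    nlinarith [sq_nonneg y]
  · refine (norm_sub_le _ _).trans ?_
    have h1 : ‖Complex.exp (y * Complex.I) - 1‖ ≤ |y| := by
      rw [mul_comm]
      exact Real.norm_exp_I_mul_ofReal_sub_one_le
    rw [hy]
    nlinarith [sq_abs y]

section Near

variable {ι κ : Type*} [DecidableEq ι] [Fintype κ]

/-- The indices `j` such that `N j` meets `N k`. -/
def near (N : κ → Finset ι) (k : κ) : Finset κ := Finset.univ.filter fun j => ¬Disjoint (N k) (N j)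

theorem mem_near {N : κ → Finset ι} {k j : κ} : j ∈ near N k ↔ ¬Disjoint (N k) (N j) := by
  simp [near]

theorem near_comm {N : κ → Finset ι} {k j : κ} : j ∈ near N k ↔ k ∈ near N j := by
  rw [mem_near, mem_near, disjoint_comm]

end Near

section Stein

variable {ι S κ : Type*} [Fintype ι] [DecidableEq ι] [Fintype S] [Fintype κ]

theorem iidMean_ofReal (w : S → ℝ) (f : (ι → S) → ℝ) :
    iidMean w (fun x => (f x : ℂ)) = ((iidMean w f : ℝ) : ℂ) := by
  simp [iidMean]

theorem sq_iidMean_le {w : S → ℝ} (hw : ∑ s, w s = 1) (hw0 : ∀ s, 0 ≤ w s) (f : (ι → S) → ℝ) :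
    iidMean w f ^ 2 ≤ iidMean w (fun x => f x ^ 2) := by
  have h := iidMean_sq_sub_le hw (f := f) (c := iidMean w f) rfl
  have h0 : iidMean w (fun x => (f x - iidMean w f) ^ 2)
      = iidMean w (fun x => f x ^ 2) - iidMean w f ^ 2 := by
    have : ∀ x, (f x - iidMean w f) ^ 2
        = (f x ^ 2 - (2 * iidMean w f) * f x) + iidMean w f ^ 2 := fun x => by ring
    simp only [this]
    rw [iidMean_add, iidMean_sub, iidMean_const_mul, iidMean_const hw]
    ring
  have h1 : 0 ≤ iidMean w (fun x => (f x - iidMean w f) ^ 2) :=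
    iidMean_nonneg hw0 fun x => sq_nonneg _
  linarith

variable {w : S → ℝ} {Y : κ → (ι → S) → ℝ} {N : κ → Finset ι}

/-- Pairs outside `near` are independent and centered, so their covariances vanish. -/
theorem iidMean_sq_sum (hw : ∑ s, w s = 1) (hN : ∀ k, DependsOn (Y k) (N k : Set ι))
    (hY : ∀ k, iidMean w (Y k) = 0) :
    iidMean w (fun x => (∑ k, Y k x) ^ 2)
      = iidMean w (fun x => ∑ k, Y k x * ∑ j ∈ near N k, Y j x) := by
  have : ∀ x, (∑ k, Y k x) ^ 2 = ∑ k, ∑ j, Y k x * Y j x := fun x => by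
    rw [sq, Finset.sum_mul_sum]
  simp only [this, Finset.mul_sum]
  simp only [iidMean_sum]
  refine Finset.sum_congr rfl fun k _ => ?_
  refine (Finset.sum_subset (Finset.subset_univ _) fun j _ hj => ?_).symm
  rw [mem_near, not_not] at hj
  rw [iidMean_mul_of_disjoint hw (hN k) (hN j) hj, hY, zero_mul]

theorem iidMean_sq_centered_sum_le (hw : ∑ s, w s = 1) (hw0 : ∀ s, 0 ≤ w s)
    (hN : ∀ k, DependsOn (Y k) (N k : Set ι)) {b : ℝ} {D : ℕ} (hb : ∀ k x, |Y k x| ≤ b)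
    (hD : ∀ k, (near N k).card ≤ D) (hY : ∀ k, iidMean w (Y k) = 0) :
    iidMean w (fun x => (∑ k, Y k x) ^ 2) ≤ Fintype.card κ * (D * b ^ 2) := by
  rw [iidMean_sq_sum hw hN hY]
  refine (iidMean_mono hw0 (g := fun _ => Fintype.card κ * (D * b ^ 2)) fun x => ?_).trans_eq
    (iidMean_const hw _)
  rw [← nsmul_eq_mul, ← Finset.card_univ]
  refine Finset.sum_le_card_nsmul _ _ _ fun k _ => ?_
  have hb0 : 0 ≤ b := (abs_nonneg _).trans (hb k x)
  rw [Finset.mul_sum]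
  refine (Finset.sum_le_card_nsmul _ _ (b ^ 2) fun j _ => ?_).trans ?_
  · refine (le_abs_self _).trans ?_
    rw [abs_mul, sq]
    exact mul_le_mul (hb k x) (hb j x) (abs_nonneg _) hb0
  · rw [nsmul_eq_mul]
    have : ((near N k).card : ℝ) ≤ D := by exact_mod_cast hD k
    gcongr

/-- The characteristic function of a sum of locally dependent variables almost satisfies the
differential equation of the Gaussian one. -/
theorem norm_charFun_deriv_add_le [DecidableEq κ] (hw : ∑ s, w s = 1) (hw0 : ∀ s, 0 ≤ w s)
    (hN : ∀ k, DependsOn (Y k) (N k : Set ι)) (hne : ∀ k, (N k).Nonempty)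
    {b : ℝ} {d : ℕ} (hb0 : 0 ≤ b) (hb : ∀ k x, |Y k x| ≤ b)
    (hd : ∀ k, (near N k).card ≤ d) (hY : ∀ k, iidMean w (Y k) = 0) (u : ℝ) :
    ‖iidMean w (fun x => (∑ k, Y k x : ℝ) * Complex.I
          * Complex.exp (u * ((∑ k, Y k x : ℝ) * Complex.I)))
        + u * iidMean w (fun x => (∑ k, Y k x) ^ 2)
          * iidMean w (fun x => Complex.exp (u * ((∑ k, Y k x : ℝ) * Complex.I)))‖
      ≤ Fintype.card κ * (b * (2 * (u * (d * b)) ^ 2))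
        + |u| * √(Fintype.card κ * ((d ^ 3 : ℕ) * (2 * (b * (d * b))) ^ 2)) := by
  set W : (ι → S) → ℝ := fun x => ∑ k, Y k x with hW
  set V : κ → (ι → S) → ℝ := fun k x => ∑ j ∈ near N k, Y j x with hV
  set s : ℝ := iidMean w (fun x => W x ^ 2) with hs
  set e : (ι → S) → ℂ := fun x => Complex.exp (u * (W x * Complex.I)) with he
  set E : κ → (ι → S) → ℂ := fun k x => Complex.exp (u * ((W x - V k x : ℝ) * Complex.I)) with hE
  -- Removing the terms near `k` from the exponent turns `e` into `E k`, which is independent of `Y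
  -- k`. The remainder `R k` is what is left after linearizing $e-E_k\approx iuV_ke$.
  set R : κ → (ι → S) → ℂ := fun k x => Y k x * (e x - E k x - u * Complex.I * V k x * e x) with hR
  set Q : (ι → S) → ℝ := fun x => ∑ k, Y k x * V k x with hQ
  have hsQ : s = iidMean w Q := iidMean_sq_sum hw hN hY
  have hVb : ∀ k x, |V k x| ≤ d * b := fun k x => by
    refine (Finset.abs_sum_le_sum_abs _ _).trans
      ((Finset.sum_le_card_nsmul _ _ b fun j _ => hb j x).trans ?_)
    rw [nsmul_eq_mul]
    have : ((near N k).card : ℝ) ≤ d := by exact_mod_cast hd k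
    gcongr
  have he1 : ∀ x, ‖e x‖ = 1 := fun x => by
    have : (u : ℂ) * (W x * Complex.I) = ((u * W x : ℝ) : ℂ) * Complex.I := by push_cast; ring
    rw [he]
    simp only [this]
    exact Complex.norm_exp_ofReal_mul_I _
  -- The linear terms $iY_k\cdot iuV_ke$ add up to $-uQe$; with $use$ this is $-u(Q-s)e$. So the
  -- three groups are a term of mean zero, the fluctuation of `Q`, and the Taylor remainders.
  have hpt : ∀ x, W x * Complex.I * e x + u * s * e x
      = ((∑ k, Complex.I * (Y k x * E k x)) + (-u) * (((Q x - s : ℝ) : ℂ) * e x))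
        + ∑ k, Complex.I * R k x := by
    intro x
    have h1 : (W x : ℂ) = ∑ k, (Y k x : ℂ) := by simp [hW]
    have h2 : (Q x : ℂ) = ∑ k, (Y k x : ℂ) * V k x := by simp [hQ]
    have h3 : ∑ k, Complex.I * R k x = Complex.I * (e x * W x) - ∑ k, Complex.I * (Y k x * E k x)
        + u * e x * Q x := by
      rw [h1, h2, Finset.mul_sum, Finset.mul_sum, Finset.mul_sum, ← Finset.sum_sub_distrib,
        ← Finset.sum_add_distrib]
      refine Finset.sum_congr rfl fun k _ => ?_
      simp only [hR]
      linear_combination (-(u : ℂ) * Y k x * V k x * e x) * Complex.I_mul_I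
    rw [h3]
    push_cast
    ring
  have hzero : ∀ k, iidMean w (fun x => (Y k x : ℂ) * E k x) = 0 := by
    intro k
    have hVdep : DependsOn (E k) ((Finset.univ.filter fun j => j ∉ near N k).biUnion N : Set ι) := by
      have hWV : ∀ x, W x - V k x = ∑ j with j ∉ near N k, Y j x := fun x => by
        simp only [hW, hV]
        rw [sub_eq_iff_eq_add', ← Finset.sum_filter_add_sum_filter_not Finset.univ
          (fun j => j ∈ near N k)]
        simp
      have := dependsOn_sum (Finset.univ.filter fun j => j ∉ near N k) hN
      intro x y hxy
      simp only [hE, hWV]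
      have hsum := this hxy
      simp only at hsum
      rw [hsum]
    rw [iidMean_mul_of_disjoint (f := fun x => (Y k x : ℂ)) (g := E k) hw
      (A := N k) (fun x y hxy => by simp only [hN k hxy]) hVdep, iidMean_ofReal, hY]
    · simp
    · rw [Finset.disjoint_biUnion_right]
      intro j hj
      have := (Finset.mem_filter.1 hj).2
      rwa [mem_near, not_not] at this
  have hsplit : iidMean w (fun x => (W x : ℂ) * Complex.I * e x) + u * s * iidMean w e
      = -u * iidMean w (fun x => ((Q x - s : ℝ) : ℂ) * e x)
        + ∑ k, iidMean w (fun x => Complex.I * R k x) := by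
    rw [← iidMean_const_mul, ← iidMean_add]
    simp only [hpt]
    rw [iidMean_add, iidMean_add, iidMean_sum, iidMean_sum]
    simp only [iidMean_const_mul, hzero]
    simp
  have hRb : ∀ k x, ‖Complex.I * R k x‖ ≤ b * (2 * (u * (d * b)) ^ 2) := by
    intro k x
    have hEe : E k x = e x * Complex.exp ((-(u * V k x) : ℝ) * Complex.I) := by
      simp only [hE, he, ← Complex.exp_add]
      congr 1
      push_cast
      ring
    have : R k x = Y k x * (-(e x * (Complex.exp ((-(u * V k x) : ℝ) * Complex.I) - 1
        - (-(u * V k x) : ℝ) * Complex.I))) := by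
      simp only [hR, hEe]
      push_cast
      ring
    rw [this, norm_mul, Complex.norm_I, one_mul, norm_mul, norm_neg, norm_mul, he1, one_mul,
      Complex.norm_real, Real.norm_eq_abs]
    refine mul_le_mul (hb k x) ((norm_exp_sub_one_sub_le _).trans ?_) (norm_nonneg _) hb0
    rw [neg_sq]
    have : (V k x) ^ 2 ≤ (d * b) ^ 2 := sq_le_sq' (abs_le.1 (hVb k x)).1 (abs_le.1 (hVb k x)).2
    nlinarith [sq_nonneg u, mul_le_mul_of_nonneg_left this (sq_nonneg u)]
  have hRsum : ‖∑ k, iidMean w (fun x => Complex.I * R k x)‖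
      ≤ Fintype.card κ * (b * (2 * (u * (d * b)) ^ 2)) := by
    rw [← nsmul_eq_mul, ← Finset.card_univ]
    refine (norm_sum_le _ _).trans (Finset.sum_le_card_nsmul _ _ _ fun k _ => ?_)
    exact (norm_iidMean_le hw0 _).trans ((iidMean_mono hw0 (hRb k)).trans_eq (iidMean_const hw _))
  -- `Q` is again a sum of locally dependent variables, on the enlarged sets `M k`, so the crude
  -- variance bound applies to it.
  have hQvar : iidMean w (fun x => (Q x - s) ^ 2)
      ≤ Fintype.card κ * ((d ^ 3 : ℕ) * (2 * (b * (d * b))) ^ 2) := by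
    set a : κ → ℝ := fun k => iidMean w (fun x => Y k x * V k x) with ha
    set M : κ → Finset ι := fun k => (near N k).biUnion N with hM
    have hself : ∀ k, k ∈ near N k := fun k => by
      rw [mem_near, disjoint_self]
      exact (hne k).ne_empty
    have hAb : ∀ k x, |Y k x * V k x| ≤ b * (d * b) := fun k x => by
      rw [abs_mul]
      exact mul_le_mul (hb k x) (hVb k x) (abs_nonneg _) hb0
    have hab : ∀ k, |a k| ≤ b * (d * b) := fun k => by
      rw [← Real.norm_eq_abs]
      exact (norm_iidMean_le hw0 _).trans ((iidMean_mono hw0 (hAb k)).trans_eq (iidMean_const hw _))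
    have hQs : ∀ x, Q x - s = ∑ k, (Y k x * V k x - a k) := fun x => by
      rw [Finset.sum_sub_distrib, hsQ]
      simp only [hQ, ha, iidMean_sum]
    simp only [hQs]
    refine iidMean_sq_centered_sum_le hw hw0 (Y := fun k x => Y k x * V k x - a k) (N := M)
      (fun k => ?_) (fun k x => ?_) (fun k => ?_) (fun k => ?_)
    · have h1 := dependsOn_sum (near N k) hN
      intro x y hxy
      have h2 : Y k x = Y k y := hN k fun i hi => hxy i
        (Finset.mem_coe.2 (Finset.mem_biUnion.2 ⟨k, hself k, hi⟩))
      simp only [hV, h1 hxy, h2]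
    · refine (abs_sub _ _).trans ?_
      linarith [hAb k x, hab k]
    · have hsub : near M k ⊆ (near N k).biUnion fun j => (near N j).biUnion fun j' => near N j' := by
        intro k' hk'
        rw [mem_near, Finset.not_disjoint_iff] at hk'
        obtain ⟨i, hi, hi'⟩ := hk'
        obtain ⟨j, hj, hij⟩ := Finset.mem_biUnion.1 hi
        obtain ⟨j', hj', hij'⟩ := Finset.mem_biUnion.1 hi'
        refine Finset.mem_biUnion.2 ⟨j, hj, Finset.mem_biUnion.2 ⟨j', ?_, near_comm.1 hj'⟩⟩
        rw [mem_near, Finset.not_disjoint_iff]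
        exact ⟨i, hij, hij'⟩
      refine (Finset.card_le_card hsub).trans ?_
      refine (Finset.card_biUnion_le_card_mul _ _ (d * d) fun j _ =>
        (Finset.card_biUnion_le_card_mul _ _ d fun j' _ => hd j').trans ?_).trans ?_
      · gcongr; exact hd j
      · calc _ ≤ d * (d * d) := by gcongr; exact hd k
          _ = d ^ 3 := by ring
    · rw [iidMean_sub, iidMean_const hw, sub_self]
  have hQabs : ‖iidMean w (fun x => ((Q x - s : ℝ) : ℂ) * e x)‖
      ≤ √(Fintype.card κ * ((d ^ 3 : ℕ) * (2 * (b * (d * b))) ^ 2)) := by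
    refine (norm_iidMean_le hw0 _).trans ?_
    have : ∀ x, ‖((Q x - s : ℝ) : ℂ) * e x‖ = |Q x - s| := fun x => by
      rw [norm_mul, he1, mul_one, Complex.norm_real, Real.norm_eq_abs]
    simp only [this]
    refine Real.le_sqrt_of_sq_le ((sq_iidMean_le hw hw0 _).trans ?_)
    simpa only [sq_abs] using hQvar
  rw [hsplit]
  refine (norm_add_le _ _).trans ?_
  rw [norm_mul, norm_neg, Complex.norm_real, Real.norm_eq_abs, add_comm]
  gcongr

end Stein

/-- With the integrating factor $g(v)=e^{sv^2/2}$, the derivative of $fg$ is $(f'+svf)g$, which is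
small on $[-U,U]$. The mean value inequality bounds $fg-1$, and multiplying back by
$e^{-su^2/2}\le1$ loses nothing. -/
theorem norm_sub_gaussian_le {f f' : ℝ → ℂ} {s ε U : ℝ} (hs : 0 ≤ s)
    (hf : ∀ u, HasDerivAt f (f' u) u)
    (h0 : f 0 = 1) (hbound : ∀ u, |u| ≤ U → ‖f' u + u * s * f u‖ ≤ ε) {u : ℝ} (hu : |u| ≤ U) :
    ‖f u - Complex.exp (-(s * u ^ 2 / 2))‖ ≤ ε * Real.exp (s * U ^ 2 / 2) * U := by
  have hU : 0 ≤ U := (abs_nonneg u).trans hu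
  have hε : 0 ≤ ε := (norm_nonneg _).trans (hbound u hu)
  set g : ℝ → ℂ := fun v => Complex.exp ((s * v ^ 2 / 2 : ℝ)) with hg
  have hgd : ∀ v, HasDerivAt g (s * v * g v) v := by
    intro v
    have h1 : HasDerivAt (fun v : ℝ => s * v ^ 2 / 2) (s * v) v := by
      exact (((hasDerivAt_pow 2 v).const_mul s).div_const 2).congr_deriv (by norm_num; ring)
    exact h1.ofReal_comp.cexp.congr_deriv (by simp only [hg]; push_cast; ring)
  have hd : ∀ v, HasDerivAt (fun v => f v * g v) ((f' v + v * s * f v) * g v) v := by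
    intro v
    exact ((hf v).mul (hgd v)).congr_deriv (by ring)
  have hgn : ∀ v, ‖g v‖ = Real.exp (s * v ^ 2 / 2) := fun v => by
    simp only [hg, Complex.norm_exp_ofReal]
  have hmv := (convex_Icc (-U) U).norm_image_sub_le_of_norm_hasDerivWithin_le
    (f := fun v => f v * g v) (C := ε * Real.exp (s * U ^ 2 / 2)) (x := 0) (y := u)
    (fun v _ => (hd v).hasDerivWithinAt) (fun v hv => ?_) ⟨by linarith, hU⟩ (abs_le.1 hu)
  · have hg0 : g 0 = 1 := by simp [hg]
    simp only [h0, hg0, mul_one, sub_zero] at hmv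
    have h1 : f u - Complex.exp (-(s * u ^ 2 / 2))
        = (f u * g u - 1) * Complex.exp (-(s * u ^ 2 / 2)) := by
      rw [sub_mul, one_mul, mul_assoc]
      congr 1
      simp only [hg]
      rw [← Complex.exp_add]
      push_cast
      simp
    have h2 : ‖Complex.exp (-((s : ℂ) * u ^ 2 / 2))‖ ≤ 1 := by
      have : (-((s : ℂ) * u ^ 2 / 2)) = ((-(s * u ^ 2 / 2) : ℝ) : ℂ) := by push_cast; ring
      rw [this, Complex.norm_exp_ofReal, Real.exp_le_one_iff]
      have := mul_nonneg hs (sq_nonneg u)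
      linarith
    rw [h1, norm_mul]
    calc _ ≤ ‖f u * g u - 1‖ * 1 := by gcongr
      _ ≤ ε * Real.exp (s * U ^ 2 / 2) * ‖u‖ := by rw [mul_one]; exact hmv
      _ ≤ _ := by rw [Real.norm_eq_abs]; gcongr
  · have hvU : |v| ≤ U := abs_le.2 hv
    rw [norm_mul, hgn]
    have : v ^ 2 ≤ U ^ 2 := sq_le_sq' hv.1 hv.2
    gcongr
    exact hbound v hvU

/-! ### Local functionals of a Bernoulli sequence -/

theorem sum_bern (t : ℝ) : ∑ b, bern t b = 1 := by simp [bern]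

theorem sum_bern_mul_bit (t : ℝ) : ∑ b, bern t b * bit b = t := by simp [bern, bit]

theorem iidMean_bern_window {ℓ n : ℕ} (hn : ℓ ≤ n) (ψ : (Fin ℓ → Bool) → ℝ) (t : ℝ) (k : Fin n) :
    iidMean (bern t) (fun x : Fin n → Bool => ψ fun j => x (cyc k j)) = meanProfile ψ t :=
  iidMean_window hn (sum_bern t) ψ id (sum_bern_mul_bit t) k

theorem bern_nonneg {t : ℝ} (ht : t ∈ Set.Icc (0 : ℝ) 1) (b : Bool) : 0 ≤ bern t b := by
  cases b <;> simp [bern, ht.1, ht.2]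

/-- A common place is at some offset in each of the two windows, and the two offsets determine the
second window. -/
theorem card_near_window (ℓ n : ℕ) (k : Fin n) : (near (window ℓ) k).card ≤ ℓ ^ 2 := by
  have hsub : near (window ℓ) k ⊆ (Finset.univ : Finset (Fin ℓ × Fin ℓ)).biUnion
      fun p => Finset.univ.filter fun j => cyc j p.2 = cyc k p.1 := by
    intro j hj
    rw [mem_near, Finset.not_disjoint_iff] at hj
    obtain ⟨i, hi, hi'⟩ := hj
    obtain ⟨a, _, rfl⟩ := Finset.mem_image.1 hi
    obtain ⟨b, _, hb⟩ := Finset.mem_image.1 hi'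
    exact Finset.mem_biUnion.2 ⟨(a, b), Finset.mem_univ _, by simpa using hb⟩
  refine (Finset.card_le_card hsub).trans
    ((Finset.card_biUnion_le_card_mul _ _ 1 fun p _ => ?_).trans ?_)
  · refine Finset.card_le_one.2 fun i hi j hj => ?_
    exact (cyc_bijective n p.2).1
      ((Finset.mem_filter.1 hi).2.trans (Finset.mem_filter.1 hj).2.symm)
  · simp [sq]

/-- A place in only one of the sets contributes a centered factor, hence 0; a common place
contributes the variance $t(1-t)$. -/
theorem iidMean_prod_mul_prod {n : ℕ} (t : ℝ) (P Q : Finset (Fin n)) :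
    iidMean (bern t) (fun x : Fin n → Bool => (∏ i ∈ P, (bit (x i) - t)) * ∏ i ∈ Q, (bit (x i) - t))
      = if P = Q then (t * (1 - t)) ^ P.card else 0 := by
  have h1 : ∀ x : Fin n → Bool, (∏ i ∈ P, (bit (x i) - t)) * ∏ i ∈ Q, (bit (x i) - t)
      = ∏ i, ((if i ∈ P then bit (x i) - t else 1) * if i ∈ Q then bit (x i) - t else 1) := by
    intro x
    rw [Finset.prod_mul_distrib, Finset.prod_ite_mem, Finset.prod_ite_mem]
    simp
  simp only [h1]
  rw [iidMean_prod_eval (sum_bern t) (fun i s =>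
    (if i ∈ P then bit s - t else 1) * if i ∈ Q then bit s - t else 1)]
  have hsq : ∑ s, bern t s * ((bit s - t) * (bit s - t)) = t * (1 - t) := by
    simp [bern, bit]; ring
  have hlin : ∑ s, bern t s * (bit s - t) = 0 := by
    simp [bern, bit]; ring
  split_ifs with h
  · subst h
    rw [← Finset.prod_subset (Finset.subset_univ P)]
    · rw [Finset.prod_congr rfl (g := fun _ => t * (1 - t)), Finset.prod_const]
      intro i hi
      simpa [hi] using hsq
    · intro i _ hi
      simpa [hi] using sum_bern t
  · have : ∃ i, ¬(i ∈ P ↔ i ∈ Q) := by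
      by_contra hcon
      push Not at hcon
      exact h (Finset.ext hcon)
    obtain ⟨i, hi⟩ := this
    refine Finset.prod_eq_zero (Finset.mem_univ i) ?_
    by_cases hP : i ∈ P
    · have hQ : i ∉ Q := fun hQ => hi ⟨fun _ => hQ, fun _ => hP⟩
      simpa [hP, hQ] using hlin
    · have hQ : i ∈ Q := by
        by_contra hQ
        exact hi ⟨fun h => (hP h).elim, fun h => (hQ h).elim⟩
      simpa [hP, hQ] using hlin

/-- Both strings contain the place 0, so each starting point lies ahead of the other by some offset
below $\ell$. The two offsets add up to a multiple of $n$ and to less than $2\ell\le n$, so both are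
0. -/
theorem image_cyc_eq_iff {ℓ n : ℕ} (hn : 2 * ℓ ≤ n) {A B : Finset ℕ} (hA : A ∈ strings ℓ)
    (hB : B ∈ strings ℓ) (k j : Fin n) :
    A.image (cyc k) = B.image (cyc j) ↔ A = B ∧ k = j := by
  constructor
  · intro h
    obtain ⟨hA1, hA0⟩ := Finset.mem_filter.1 hA
    obtain ⟨hB1, hB0⟩ := Finset.mem_filter.1 hB
    rw [Finset.mem_powerset] at hA1 hB1
    have hcyc0 : ∀ k : Fin n, cyc k 0 = k := fun k => by
      apply Fin.ext; simp [cyc, Nat.mod_eq_of_lt k.isLt]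
    have hinj : ∀ (k : Fin n) {a b : ℕ}, a < n → b < n → cyc k a = cyc k b → a = b := by
      intro k a b ha hb hab
      exact congrArg Fin.val (cyc_injective le_rfl k (a₁ := ⟨a, ha⟩) (a₂ := ⟨b, hb⟩) hab)
    have hk : cyc k 0 ∈ B.image (cyc j) := h ▸ Finset.mem_image_of_mem _ hA0
    have hj : cyc j 0 ∈ A.image (cyc k) := h ▸ Finset.mem_image_of_mem _ hB0
    obtain ⟨b, hb, hbk⟩ := Finset.mem_image.1 hk
    obtain ⟨a, ha, haj⟩ := Finset.mem_image.1 hj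
    have ha' := Finset.mem_range.1 (hA1 ha)
    have hb' := Finset.mem_range.1 (hB1 hb)
    rw [hcyc0] at haj
    rw [← haj, cyc_cyc] at hbk
    have hab := hinj k (by omega) (by omega) hbk
    obtain rfl : a = 0 := by omega
    rw [hcyc0] at haj
    subst haj
    have hsub : ∀ A B : Finset ℕ, A ⊆ Finset.range ℓ → B ⊆ Finset.range ℓ →
        A.image (cyc k) = B.image (cyc k) → A ⊆ B := by
      intro A B hA hB h a ha
      have : cyc k a ∈ B.image (cyc k) := h ▸ Finset.mem_image_of_mem _ ha
      obtain ⟨b, hb, hba⟩ := Finset.mem_image.1 this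
      have ha' := Finset.mem_range.1 (hA ha)
      have hb' := Finset.mem_range.1 (hB hb)
      rwa [← hinj k (by omega) (by omega) hba]
    exact ⟨(hsub A B hA1 hB1 h).antisymm (hsub B A hB1 hA1 h.symm), rfl⟩
  · rintro ⟨rfl, rfl⟩
    rfl

theorem iidMean_stringSum_mul {ℓ n : ℕ} (hn : 2 * ℓ ≤ n) {A B : Finset ℕ} (hA : A ∈ strings ℓ)
    (hB : B ∈ strings ℓ) (t : ℝ) :
    iidMean (bern t) (fun x : Fin n → Bool => stringSum A t x * stringSum B t x)
      = if A = B then n * (t * (1 - t)) ^ A.card else 0 := by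
  have hinj : ∀ {A : Finset ℕ}, A ∈ strings ℓ → ∀ k : Fin n, Set.InjOn (cyc k) (A : Set ℕ) := by
    intro A hA k a ha b hb hab
    have hA1 := Finset.mem_powerset.1 (Finset.mem_filter.1 hA).1
    have ha' := Finset.mem_range.1 (hA1 ha)
    have hb' := Finset.mem_range.1 (hA1 hb)
    exact congrArg Fin.val
      (cyc_injective le_rfl k (a₁ := ⟨a, by omega⟩) (a₂ := ⟨b, by omega⟩) hab)
  have himg : ∀ {A : Finset ℕ}, A ∈ strings ℓ → ∀ (k : Fin n) (x : Fin n → Bool),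
      ∏ a ∈ A, (bit (x (cyc k a)) - t) = ∏ i ∈ A.image (cyc k), (bit (x i) - t) :=
    fun hA k x => (Finset.prod_image (f := fun i => bit (x i) - t) (hinj hA k)).symm
  simp only [stringSum, Finset.sum_mul_sum, himg hA, himg hB]
  simp only [iidMean_sum, iidMean_prod_mul_prod, image_cyc_eq_iff hn hA hB,
    Finset.card_image_of_injOn (hinj hA _)]
  by_cases h : A = B
  · simp [h]
  · simp [h]

/-- This is where $\sigma^2$ arises: the $S_\alpha$ in the expansion are orthogonal, with second
moments $n(t(1-t))^{\nu(\alpha)}$. -/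
theorem iidMean_sq_localSum {ℓ n : ℕ} (hn : 2 * ℓ ≤ n) (ψ : (Fin ℓ → Bool) → ℝ) (t : ℝ) :
    iidMean (bern t) (fun x : Fin n → Bool => (localSum ψ x - meanProfile ψ t * n) ^ 2)
      = n * limitVariance ψ t := by
  have h1 : ∀ x : Fin n → Bool, (localSum ψ x - meanProfile ψ t * n) ^ 2
      = ∑ A ∈ strings ℓ, ∑ B ∈ strings ℓ,
        (stringCoeff ψ A t * stringCoeff ψ B t) * (stringSum A t x * stringSum B t x) := by
    intro x
    rw [localSum_expansion ψ t x, add_sub_cancel_left, sq, Finset.sum_mul_sum]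
    refine Finset.sum_congr rfl fun A _ => Finset.sum_congr rfl fun B _ => ?_
    ring
  simp only [h1]
  simp only [iidMean_sum, iidMean_const_mul]
  rw [limitVariance, Finset.mul_sum]
  refine Finset.sum_congr rfl fun A hA => ?_
  rw [Finset.sum_eq_single A]
  · rw [iidMean_stringSum_mul hn hA hA, if_pos rfl]
    ring
  · intro B hB hne
    rw [iidMean_stringSum_mul hn hA hB, if_neg hne.symm, mul_zero]
  · exact fun h => (h hA).elim

/-- The normalized local functional. -/
def normalizedSum {ℓ : ℕ} (ψ : (Fin ℓ → Bool) → ℝ) (t : ℝ) {n : ℕ} (x : Fin n → Bool) : ℝ :=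
  (√(n : ℝ))⁻¹ * (localSum ψ x - meanProfile ψ t * n)

theorem abs_meanProfile_le {ℓ : ℕ} (ψ : (Fin ℓ → Bool) → ℝ) {K : ℝ} (hK : ∀ y, |ψ y| ≤ K) {t : ℝ}
    (ht : t ∈ Set.Icc (0 : ℝ) 1) : |meanProfile ψ t| ≤ K := by
  have h : meanProfile ψ t = iidMean (bern t) ψ := by
    simp [meanProfile, iidMean, mul_comm]
  rw [h, ← Real.norm_eq_abs]
  exact (norm_iidMean_le (bern_nonneg ht) ψ).trans
    ((iidMean_mono (bern_nonneg ht) hK).trans_eq (iidMean_const (sum_bern t) K))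

theorem normalizedSum_eq_sum {ℓ n : ℕ} (ψ : (Fin ℓ → Bool) → ℝ) (t : ℝ) (x : Fin n → Bool) :
    normalizedSum ψ t x
      = ∑ k : Fin n, (√(n : ℝ))⁻¹ * ((ψ fun j => x (cyc k j)) - meanProfile ψ t) := by
  rw [normalizedSum, localSum, ← Finset.mul_sum, Finset.sum_sub_distrib, Finset.sum_const,
    Finset.card_univ, Fintype.card_fin, nsmul_eq_mul, mul_comm (n : ℝ)]

/-- The summands are $O(n^{-1/2})$ with boundedly many neighbours, so both error terms of the
approximate differential equation are $O(n^{-1/2})$: one is $n\cdot n^{-3/2}$, the other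
$\sqrt{n\cdot n^{-2}}$. -/
theorem tendsto_charFun_normalizedSum {ℓ : ℕ} (hℓ : 0 < ℓ) (ψ : (Fin ℓ → Bool) → ℝ) {t : ℝ}
    (ht : t ∈ Set.Icc (0 : ℝ) 1) (u : ℝ) :
    Tendsto (fun n : ℕ => iidMean (bern t) (fun x : Fin n → Bool =>
        Complex.exp (u * ((normalizedSum ψ t x : ℝ) * Complex.I)))) atTop
      (𝓝 (Complex.exp (-(limitVariance ψ t * u ^ 2 / 2)))) := by
  obtain ⟨K, hK⟩ : ∃ K, ∀ y, |ψ y| ≤ K :=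
    ⟨∑ y, |ψ y|, fun y => Finset.single_le_sum (f := fun y => |ψ y|)
      (fun _ _ => abs_nonneg _) (Finset.mem_univ y)⟩
  have hK0 : 0 ≤ K := (abs_nonneg _).trans (hK fun _ => true)
  set B : ℝ := 2 * K with hB
  set d : ℕ := ℓ ^ 2 with hd
  set U : ℝ := |u| with hU
  set C : ℝ := 2 * B ^ 3 * d ^ 2 * U ^ 2 + U * √((d ^ 3 : ℕ) * (2 * d * B ^ 2) ^ 2) with hC
  set s := limitVariance ψ t with hs
  have hs0 : 0 ≤ s := limitVariance_nonneg ψ ht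
  rw [tendsto_iff_norm_sub_tendsto_zero]
  have hlim : Tendsto (fun n : ℕ => (√(n : ℝ))⁻¹ * C * Real.exp (s * U ^ 2 / 2) * U) atTop
      (𝓝 0) := by
    have : Tendsto (fun n : ℕ => (√(n : ℝ))⁻¹) atTop (𝓝 0) :=
      tendsto_inv_atTop_zero.comp (Real.tendsto_sqrt_atTop.comp tendsto_natCast_atTop_atTop)
    simpa using ((this.mul_const C).mul_const (Real.exp (s * U ^ 2 / 2))).mul_const U
  refine squeeze_zero' (Eventually.of_forall fun _ => norm_nonneg _) ?_ hlim
  filter_upwards [eventually_ge_atTop (2 * ℓ)] with n hn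
  have hn0 : (0 : ℝ) < n := by exact_mod_cast (by omega : 0 < n)
  have hr0 : 0 < √(n : ℝ) := Real.sqrt_pos.2 hn0
  have hrn : √(n : ℝ) ^ 2 = n := Real.sq_sqrt hn0.le
  set r := √(n : ℝ) with hr
  have hw := sum_bern t
  have hw0 := bern_nonneg ht
  set f : ℝ → ℂ := fun v => iidMean (bern t) (fun x : Fin n → Bool =>
        Complex.exp (v * ((normalizedSum ψ t x : ℝ) * Complex.I))) with hf
  set f' : ℝ → ℂ := fun v => iidMean (bern t) (fun x : Fin n → Bool =>
        (normalizedSum ψ t x : ℝ) * Complex.I *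
          Complex.exp (v * ((normalizedSum ψ t x : ℝ) * Complex.I))) with hf'
  refine norm_sub_gaussian_le (f := f) (f' := f') hs0 (fun v => ?_) ?_ (fun v hv => ?_) le_rfl
  · simp only [hf, hf', iidMean]
    refine HasDerivAt.fun_sum fun x _ => HasDerivAt.const_smul _ ?_
    exact (((hasDerivAt_id v).ofReal_comp.mul_const
      ((normalizedSum ψ t x : ℝ) * Complex.I)).cexp).congr_deriv (by simp [mul_comm])
  · simp only [hf, Complex.ofReal_zero, zero_mul, Complex.exp_zero]
    exact iidMean_const hw 1
  · have hE : ∀ k : Fin n, iidMean (bern t) (fun x : Fin n → Bool =>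
        r⁻¹ * ((ψ fun j => x (cyc k j)) - meanProfile ψ t)) = 0 := fun k => by
      rw [iidMean_const_mul, iidMean_sub, iidMean_const hw, iidMean_bern_window (by omega),
        sub_self, mul_zero]
    have hbd : ∀ (k : Fin n) (x : Fin n → Bool),
        |r⁻¹ * ((ψ fun j => x (cyc k j)) - meanProfile ψ t)| ≤ r⁻¹ * B := fun k x => by
      rw [abs_mul, abs_of_pos (inv_pos.2 hr0)]
      gcongr
      refine (abs_sub _ _).trans ?_
      linarith [hK fun j => x (cyc k j), abs_meanProfile_le ψ hK ht]
    have hmain := norm_charFun_deriv_add_le (N := window ℓ)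
      (Y := fun k x => r⁻¹ * ((ψ fun j => x (cyc k j)) - meanProfile ψ t)) hw hw0
      (fun k => dependsOn_window (fun y => r⁻¹ * (ψ y - meanProfile ψ t)) k)
      (fun k => ⟨_, cyc_mem_window k ⟨0, hℓ⟩⟩) (b := r⁻¹ * B) (d := d) (by positivity) hbd
      (card_near_window ℓ n) hE v
    have hNS : ∀ x : Fin n → Bool,
        ∑ k : Fin n, r⁻¹ * ((ψ fun j => x (cyc k j)) - meanProfile ψ t) = normalizedSum ψ t x :=
      fun x => (normalizedSum_eq_sum ψ t x).symm
    simp only [hNS] at hmain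
    have hvar : iidMean (bern t) (fun x : Fin n → Bool => normalizedSum ψ t x ^ 2) = s := by
      simp only [normalizedSum, mul_pow]
      rw [iidMean_const_mul, iidMean_sq_localSum hn, inv_pow, ← hr, hrn, ← mul_assoc,
        inv_mul_cancel₀ hn0.ne', one_mul]
    rw [hvar] at hmain
    refine hmain.trans ?_
    rw [Fintype.card_fin, hC, mul_add]
    have hv2 : v ^ 2 ≤ U ^ 2 := by
      rw [← sq_abs v]
      exact pow_le_pow_left₀ (abs_nonneg v) hv 2
    refine add_le_add ?_ ?_
    · have : (n : ℝ) * (r⁻¹ * B * (2 * (v * (d * (r⁻¹ * B))) ^ 2))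
          = r⁻¹ * (2 * B ^ 3 * d ^ 2 * v ^ 2) := by
        rw [← hrn]; field_simp
      rw [this]
      gcongr
    · have : (n : ℝ) * ((d ^ 3 : ℕ) * (2 * (r⁻¹ * B * (d * (r⁻¹ * B)))) ^ 2)
          = (r⁻¹) ^ 2 * ((d ^ 3 : ℕ) * (2 * d * B ^ 2) ^ 2) := by
        rw [← hrn]; field_simp
      rw [this, Real.sqrt_mul (by positivity), Real.sqrt_sq (by positivity)]
      calc _ ≤ U * (r⁻¹ * √((d ^ 3 : ℕ) * (2 * d * B ^ 2) ^ 2)) := by gcongr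
        _ = _ := by ring

theorem abs_pow_le_factorial_mul_exp_add (y : ℝ) (q : ℕ) :
    |y| ^ q ≤ q.factorial * (Real.exp y + Real.exp (-y)) := by
  have h := Real.pow_div_factorial_le_exp |y| (abs_nonneg y) q
  rw [div_le_iff₀ (by positivity), mul_comm] at h
  refine h.trans ?_
  gcongr
  rcases abs_cases y with ⟨h, _⟩ | ⟨h, _⟩ <;> rw [h] <;>
    linarith [Real.exp_pos y, Real.exp_pos (-y)]

/-- Exponential moments at $\lambda=\pm n^{-1/2}$ are bounded uniformly in $n$ and dominate every
power. -/
theorem eventually_moment_normalizedSum_le {ℓ : ℕ} (hℓ : 0 < ℓ) (ψ : (Fin ℓ → Bool) → ℝ) {t : ℝ}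
    (ht : t ∈ Set.Icc (0 : ℝ) 1) (q : ℕ) :
    ∃ C : ℝ, ∀ᶠ n : ℕ in atTop,
      iidMean (bern t) (fun x : Fin n → Bool => |normalizedSum ψ t x| ^ q) ≤ C := by
  obtain ⟨K, hK⟩ : ∃ K, ∀ y, |ψ y| ≤ K :=
    ⟨∑ y, |ψ y|, fun y => Finset.single_le_sum (f := fun y => |ψ y|)
      (fun _ _ => abs_nonneg _) (Finset.mem_univ y)⟩
  have hK0 : 0 ≤ K := (abs_nonneg _).trans (hK fun _ => true)
  have hw := sum_bern t
  have hw0 := bern_nonneg ht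
  refine ⟨q.factorial * (2 * Real.exp ((2 * ℓ) ^ 2 * (2 * K) ^ 2)), ?_⟩
  have hlim : Tendsto (fun n : ℕ => 2 * ℓ * (√(n : ℝ))⁻¹ * (2 * K)) atTop (𝓝 0) := by
    have : Tendsto (fun n : ℕ => (√(n : ℝ))⁻¹) atTop (𝓝 0) :=
      tendsto_inv_atTop_zero.comp (Real.tendsto_sqrt_atTop.comp tendsto_natCast_atTop_atTop)
    simpa using (this.const_mul (2 * ℓ : ℝ)).mul_const (2 * K)
  filter_upwards [eventually_ge_atTop (2 * ℓ), hlim.eventually_le_const zero_lt_one] with n hn hsmall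
  have hn0 : (0 : ℝ) < n := by exact_mod_cast (by omega : 0 < n)
  have hr0 : 0 < √(n : ℝ) := Real.sqrt_pos.2 hn0
  have hrn : √(n : ℝ) ^ 2 = n := Real.sq_sqrt hn0.le
  have hbd : ∀ y, |ψ y - meanProfile ψ t| ≤ 2 * K := fun y => by
    refine (abs_sub _ _).trans ?_
    linarith [hK y, abs_meanProfile_le ψ hK ht]
  have hexp : ∀ lam : ℝ, |lam| = (√(n : ℝ))⁻¹ →
      iidMean (bern t) (fun x : Fin n → Bool =>
          Real.exp (lam * ∑ k : Fin n, ((ψ fun j => x (cyc k j)) - meanProfile ψ t)))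
        ≤ Real.exp ((2 * ℓ) ^ 2 * (2 * K) ^ 2) := by
    intro lam hlam
    refine (iidMean_exp_window_sum_le hℓ hw hw0 (fun y => ψ y - meanProfile ψ t) lam
      (v := (2 * K) ^ 2) hbd (by rw [hlam]; exact hsmall) (sq_nonneg _) (fun k => ?_)
      (fun k => ?_)).trans_eq ?_
    · rw [iidMean_sub, iidMean_const hw, iidMean_bern_window (by omega), sub_self]
    · refine (iidMean_mono hw0 fun x => ?_).trans_eq (iidMean_const hw _)
      exact sq_le_sq' (abs_le.1 (hbd _)).1 (abs_le.1 (hbd _)).2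
    · congr 1
      rw [mul_pow, ← sq_abs lam, hlam, inv_pow, hrn]
      field_simp
  have hN : ∀ x : Fin n → Bool, normalizedSum ψ t x
      = (√(n : ℝ))⁻¹ * ∑ k : Fin n, ((ψ fun j => x (cyc k j)) - meanProfile ψ t) := fun x => by
    rw [normalizedSum_eq_sum, Finset.mul_sum]
  refine (iidMean_mono hw0 fun x => abs_pow_le_factorial_mul_exp_add _ q).trans ?_
  rw [iidMean_const_mul, iidMean_add]
  have h1 := hexp (√(n : ℝ))⁻¹ (abs_of_pos (inv_pos.2 hr0))
  have h2 := hexp (-(√(n : ℝ))⁻¹) (by rw [abs_neg, abs_of_pos (inv_pos.2 hr0)])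
  simp only [hN, ← neg_mul]
  gcongr
  linarith

/-! ### The mean profile near its maximum -/

/-- The mean profile as a polynomial. -/
def profilePoly {ℓ : ℕ} (ψ : (Fin ℓ → Bool) → ℝ) : Polynomial ℝ :=
  ∑ x : Fin ℓ → Bool, Polynomial.C (ψ x) * ∏ j, if x j then Polynomial.X else 1 - Polynomial.X

theorem eval_profilePoly {ℓ : ℕ} (ψ : (Fin ℓ → Bool) → ℝ) (t : ℝ) :
    (profilePoly ψ).eval t = meanProfile ψ t := by
  simp only [profilePoly, meanProfile, Polynomial.eval_finsetSum, Polynomial.eval_mul,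
    Polynomial.eval_C, Polynomial.eval_prod]
  refine Finset.sum_congr rfl fun x _ => ?_
  congr 1
  refine Finset.prod_congr rfl fun j _ => ?_
  cases x j <;> simp [bern]

theorem meanProfile_eq_eval {ℓ : ℕ} (ψ : (Fin ℓ → Bool) → ℝ) :
    meanProfile ψ = fun t => (profilePoly ψ).eval t :=
  funext fun t => (eval_profilePoly ψ t).symm

/-- As $g_0$ is a polynomial with $g_0'(t_0)=0$, $g_0(t_0)-g_0(t)=(t-t_0)^2r(t)$ with a polynomial
$r$. It is positive at $t_0$ because $g_0''(t_0)<0$ and elsewhere on $[0,1]$ because the maximum is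
unique; compactness gives the constants. -/
theorem exists_quadratic_bounds {ℓ : ℕ} {ψ : (Fin ℓ → Bool) → ℝ} {t₀ : ℝ}
    (ht₀ : t₀ ∈ Set.Ioo (0 : ℝ) 1)
    (hmax : ∀ t ∈ Set.Icc (0 : ℝ) 1, t ≠ t₀ → meanProfile ψ t < meanProfile ψ t₀)
    (hsecond : iteratedDeriv 2 (meanProfile ψ) t₀ < 0) :
    ∃ c C : ℝ, 0 < c ∧ ∀ t ∈ Set.Icc (0 : ℝ) 1,
      c * (t - t₀) ^ 2 ≤ meanProfile ψ t₀ - meanProfile ψ t ∧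
      meanProfile ψ t₀ - meanProfile ψ t ≤ C * (t - t₀) ^ 2 := by
  set P := profilePoly ψ with hP
  set p : Polynomial ℝ := Polynomial.C (meanProfile ψ t₀) - P with hp
  have hpe : ∀ t, p.eval t = meanProfile ψ t₀ - meanProfile ψ t := fun t => by
    simp [hp, hP, eval_profilePoly]
  have hd1 : P.derivative.eval t₀ = 0 := by
    have hloc : IsLocalMax (meanProfile ψ) t₀ := by
      filter_upwards [Icc_mem_nhds ht₀.1 ht₀.2] with t ht
      rcases eq_or_ne t t₀ with rfl | h
      · exact le_rfl
      · exact (hmax t ht h).le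
    have := hloc.deriv_eq_zero
    rwa [meanProfile_eq_eval, Polynomial.deriv] at this
  have hd2 : P.derivative.derivative.eval t₀ < 0 := by
    have hderiv : deriv (meanProfile ψ) = fun t => P.derivative.eval t := by
      rw [meanProfile_eq_eval]
      ext t
      rw [Polynomial.deriv]
    rwa [iteratedDeriv_succ, iteratedDeriv_one, hderiv, Polynomial.deriv] at hsecond
  obtain ⟨q, hq⟩ : (Polynomial.X - Polynomial.C t₀) ∣ p := by
    rw [Polynomial.dvd_iff_isRoot, Polynomial.IsRoot, hpe, sub_self]
  obtain ⟨r, hr⟩ : (Polynomial.X - Polynomial.C t₀) ∣ q := by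
    rw [Polynomial.dvd_iff_isRoot, Polynomial.IsRoot]
    have h1 : p.derivative.eval t₀ = 0 := by simp [hp, hd1]
    rw [hq] at h1
    simpa [Polynomial.derivative_mul] using h1
  have hrt₀ : 0 < r.eval t₀ := by
    have h1 : p.derivative.derivative.eval t₀ = - P.derivative.derivative.eval t₀ := by simp [hp]
    rw [hq, hr] at h1
    simp [Polynomial.derivative_mul] at h1
    linarith
  have hpr : ∀ t, meanProfile ψ t₀ - meanProfile ψ t = r.eval t * (t - t₀) ^ 2 := fun t => by
    rw [← hpe, hq, hr]
    simp
    ring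
  have hrpos : ∀ t ∈ Set.Icc (0 : ℝ) 1, 0 < r.eval t := by
    intro t ht
    rcases eq_or_ne t t₀ with rfl | h
    · exact hrt₀
    · have h1 := sub_pos.2 (hmax t ht h)
      rw [hpr] at h1
      exact pos_of_mul_pos_left h1 (sq_nonneg _)
  have hcont : ContinuousOn (fun t => r.eval t) (Set.Icc (0 : ℝ) 1) := r.continuous.continuousOn
  have hne : (Set.Icc (0 : ℝ) 1).Nonempty := ⟨t₀, Set.Ioo_subset_Icc_self ht₀⟩
  obtain ⟨a, ha, hamin⟩ := isCompact_Icc.exists_isMinOn hne hcont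
  obtain ⟨b, hb, hbmax⟩ := isCompact_Icc.exists_isMaxOn hne hcont
  refine ⟨r.eval a, r.eval b, hrpos a ha, fun t ht => ?_⟩
  rw [hpr]
  exact ⟨mul_le_mul_of_nonneg_right (hamin ht) (sq_nonneg _),
    mul_le_mul_of_nonneg_right (hbmax ht) (sq_nonneg _)⟩

/-! ### Deviations along the evolving sequence -/

/-- The deviation of the increment of the pattern count between `m` and `m'` from its mean. -/
def deviation {ℓ : ℕ} (ψ : (Fin ℓ → Bool) → ℝ) {n : ℕ} (τ : Equiv.Perm (Fin n)) (m m' : ℕ) : ℝ :=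
  patternCount ψ τ m' - patternCount ψ τ m
    - n * (meanProfile ψ ((m' : ℝ) / n) - meanProfile ψ ((m : ℝ) / n))

theorem deviation_eq_increment {ℓ n m m' : ℕ} (ψ : (Fin ℓ → Bool) → ℝ) (hm : m ≤ m')
    (τ : Equiv.Perm (Fin n)) :
    deviation ψ τ m m' = increment ψ ((m : ℝ) / n) ((m' : ℝ) / n) (stage m m' ∘ τ.symm) := by
  have h1 : (fun k => decide ((stage m m' ∘ τ.symm) k = 0)) = indicator τ m := by
    ext k
    simp only [indicator, Function.comp_apply, stage]
    split_ifs <;> simp_all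
  have h2 : (fun k => decide ((stage m m' ∘ τ.symm) k ≠ 2)) = indicator τ m' := by
    ext k
    simp only [indicator, Function.comp_apply, stage]
    split_ifs <;> simp_all
    omega
  rw [deviation, increment, h1, h2]
  rfl

theorem ite_lt_abs_le_exp (lam y z : ℝ) (hlam : 0 ≤ lam) :
    (if y < |z| then (1 : ℝ) else 0)
      ≤ Real.exp (-(lam * y)) * (Real.exp (lam * z) + Real.exp (-lam * z)) := by
  split_ifs with h
  · rw [mul_add, ← Real.exp_add, ← Real.exp_add]
    rcases abs_cases z with ⟨hz, _⟩ | ⟨hz, _⟩ <;> rw [hz] at h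
    · have : 1 ≤ Real.exp (-(lam * y) + lam * z) := Real.one_le_exp (by nlinarith)
      linarith [Real.exp_pos (-(lam * y) + -lam * z)]
    · have : 1 ≤ Real.exp (-(lam * y) + -lam * z) := Real.one_le_exp (by nlinarith)
      linarith [Real.exp_pos (-(lam * y) + lam * z)]
  · positivity

/-- Chernoff's bound, with the exponential moment transferred from the three-state i.i.d. sequence.
The variance proxy is proportional to $m'-m$; `lam` stays free because long and short intervals need
different choices. -/
theorem permMean_lt_abs_deviation_le {ℓ n m m' : ℕ} (hℓ : 0 < ℓ) (hn : ℓ ≤ n)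
    (ψ : (Fin ℓ → Bool) → ℝ) {K : ℝ} (hK : ∀ y, |ψ y| ≤ K) (hm : m ≤ m') (hm' : m' ≤ n)
    {lam : ℝ} (hlam0 : 0 ≤ lam) (hlam : 2 * ℓ * lam * (4 * K) ≤ 1) (y : ℝ) :
    permMean (fun τ : Equiv.Perm (Fin n) => if y < |deviation ψ τ m m'| then (1 : ℝ) else 0)
      ≤ 2 * ((n : ℝ) + 1) ^ 2
        * Real.exp ((2 * ℓ * lam) ^ 2 * (4 * K ^ 2 * ℓ * ((m' : ℝ) - m))) * Real.exp (-(lam * y)) := by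
  have hn0 : 0 < n := hℓ.trans_le hn
  have hn' : (0 : ℝ) < n := by exact_mod_cast hn0
  have hmr : (m : ℝ) ≤ m' := by exact_mod_cast hm
  have hmr' : (m' : ℝ) ≤ n := by exact_mod_cast hm'
  have hexp : ∀ lam' : ℝ, |lam'| = lam →
      permMean (fun τ : Equiv.Perm (Fin n) => Real.exp (lam' * deviation ψ τ m m'))
        ≤ ((n : ℝ) + 1) ^ 2
          * Real.exp ((2 * ℓ * lam) ^ 2 * (4 * K ^ 2 * ℓ * ((m' : ℝ) - m))) := by
    intro lam' hl
    simp only [deviation_eq_increment ψ hm]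
    refine (permMean_stage_le hn0 hm hm' (F := fun x => Real.exp (lam' *
      increment ψ ((m : ℝ) / n) ((m' : ℝ) / n) x)) fun x => (Real.exp_pos _).le).trans ?_
    gcongr
    refine (iidMean_exp_increment_le hℓ hn ψ hK (by positivity) (by gcongr)
      (by rwa [div_le_one hn']) lam' (by rwa [hl])).trans_eq ?_
    congr 1
    rw [mul_pow, mul_pow, ← sq_abs lam', hl]
    field_simp
  refine (permMean_mono fun τ => ite_lt_abs_le_exp lam y (deviation ψ τ m m') hlam0).trans ?_
  rw [permMean_const_mul, permMean_add]
  have h1 := hexp lam (abs_of_nonneg hlam0)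
  have h2 := hexp (-lam) (by rw [abs_neg, abs_of_nonneg hlam0])
  calc _ ≤ Real.exp (-(lam * y)) * (((n : ℝ) + 1) ^ 2
          * Real.exp ((2 * ℓ * lam) ^ 2 * (4 * K ^ 2 * ℓ * ((m' : ℝ) - m)))
          + ((n : ℝ) + 1) ^ 2
          * Real.exp ((2 * ℓ * lam) ^ 2 * (4 * K ^ 2 * ℓ * ((m' : ℝ) - m)))) := by gcongr
    _ = _ := by ring

/-- The number of 1's is a local functional with windows of length 1. -/
theorem iidMean_lt_abs_onesCount_le {n : ℕ} {t : ℝ} (ht : t ∈ Set.Icc (0 : ℝ) 1)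
    {lam : ℝ} (hlam0 : 0 ≤ lam) (hlam : 2 * lam ≤ 1) (y : ℝ) :
    iidMean (bern t) (fun x : Fin n → Bool => if y < |(onesCount x : ℝ) - n * t| then (1 : ℝ) else 0)
      ≤ 2 * Real.exp ((2 * lam) ^ 2 * n) * Real.exp (-(lam * y)) := by
  have hw := sum_bern t
  have hw0 := bern_nonneg ht
  have hb : ∀ b : Bool, |bit b - t| ≤ 1 := fun b => by
    rw [abs_le]
    cases b <;> simp [bit] <;> constructor <;> linarith [ht.1, ht.2]
  have hcyc0 : ∀ k : Fin n, cyc k 0 = k := fun k => by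
    apply Fin.ext; simp [cyc, Nat.mod_eq_of_lt k.isLt]
  have hsum : ∀ x : Fin n → Bool, (onesCount x : ℝ) - n * t
      = ∑ k : Fin n, (bit (x (cyc k ((0 : Fin 1) : ℕ))) - t) := fun x => by
    simp only [Fin.val_zero, hcyc0, Finset.sum_sub_distrib, Finset.sum_const, Finset.card_univ,
      Fintype.card_fin, nsmul_eq_mul, onesCount, bit, Finset.sum_boole]
  have hmean : ∀ k : Fin n, iidMean (bern t) (fun x : Fin n → Bool =>
      bit (x (cyc k ((0 : Fin 1) : ℕ))) - t) = 0 := fun k => by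
    have := iidMean_prod_eval (sum_bern t) (fun _ s => bit s - t)
      {cyc k ((0 : Fin 1) : ℕ)}
    simp only [Finset.prod_singleton] at this
    rw [this]
    simp [bern, bit]; ring
  have hexp : ∀ lam' : ℝ, |lam'| = lam →
      iidMean (bern t) (fun x : Fin n → Bool => Real.exp (lam' * ((onesCount x : ℝ) - n * t)))
        ≤ Real.exp ((2 * lam) ^ 2 * n) := by
    intro lam' hl
    simp only [hsum]
    refine (iidMean_exp_window_sum_le (ℓ := 1) one_pos hw hw0 (fun z => bit (z 0) - t) lam'
      (b := 1) (v := 1) (fun z => hb _) (by rw [hl]; simpa using hlam) zero_le_one hmean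
      (fun k => ?_)).trans_eq ?_
    · refine (iidMean_mono hw0 fun x => ?_).trans_eq (iidMean_const hw 1)
      rw [← sq_abs]
      exact pow_le_one₀ (abs_nonneg _) (hb _)
    · congr 1
      rw [mul_pow, mul_pow, ← sq_abs lam', hl]
      push_cast; ring
  refine (iidMean_mono hw0 fun x => ite_lt_abs_le_exp lam y _ hlam0).trans ?_
  rw [iidMean_const_mul, iidMean_add]
  have h1 := hexp lam (abs_of_nonneg hlam0)
  have h2 := hexp (-lam) (by rw [abs_neg, abs_of_nonneg hlam0])
  calc _ ≤ Real.exp (-(lam * y)) * (Real.exp ((2 * lam) ^ 2 * n)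
          + Real.exp ((2 * lam) ^ 2 * n)) := by gcongr
    _ = _ := by ring

/-! ### Comparison of the maximum with the value at a random time -/

/-- The deterministic core. The threshold $a^{16}$ works on both sides: beyond it the mean drops by
at least $c\,a^{32}/a^{20}=ca^{12}$, above the fluctuations $2a^{11}$; within it increments have
standard deviation of order $a^8$, well below $\sqrt n=a^{10}$. The value at $M$ lies below the peak
by at most $C\,a^{22}/a^{20}=Ca^2$ in the mean. -/
theorem patternCount_sub_le_of_deviation_le {ℓ n M : ℕ} {ψ : (Fin ℓ → Bool) → ℝ} {a t₀ c C ε : ℝ}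
    {τ : Equiv.Perm (Fin n)} (ha : 1 ≤ a) (han : a ^ 20 = n) (hc : 0 < c) (hε : 0 ≤ ε)
    (hg : ∀ t ∈ Set.Icc (0 : ℝ) 1,
      c * (t - t₀) ^ 2 ≤ meanProfile ψ t₀ - meanProfile ψ t ∧
      meanProfile ψ t₀ - meanProfile ψ t ≤ C * (t - t₀) ^ 2)
    (hC : 0 ≤ C)
    (h1 : ∀ m ≤ n, |deviation ψ τ 0 m| ≤ a ^ 11)
    (h2 : ∀ m m', m ≤ m' → m' ≤ n → (m' : ℝ) - m ≤ 2 * a ^ 16 → |deviation ψ τ m m'| ≤ ε * a ^ 10)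
    (hM : M ≤ n) (h3 : |(M : ℝ) - n * t₀| ≤ a ^ 11)
    (hbig1 : 2 * a ^ 11 + C * a ^ 2 ≤ c * a ^ 12) (hbig2 : C * a ^ 2 ≤ ε * a ^ 10)
    {m : ℕ} (hm : m ≤ n) :
    patternCount ψ τ m - patternCount ψ τ M ≤ 2 * ε * a ^ 10 := by
  have ha0 : 0 < a := zero_lt_one.trans_le ha
  have hn0 : (0 : ℝ) < n := by rw [← han]; positivity
  have hmem : ∀ k : ℕ, k ≤ n → (k : ℝ) / n ∈ Set.Icc (0 : ℝ) 1 := fun k hk =>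
    ⟨by positivity, by rw [div_le_one hn0]; exact_mod_cast hk⟩
  have hsq : ∀ k : ℕ, (n : ℝ) * ((k : ℝ) / n - t₀) ^ 2 = ((k : ℝ) - n * t₀) ^ 2 / a ^ 20 := by
    intro k
    rw [han]
    field_simp
  have hMup : (n : ℝ) * (meanProfile ψ t₀ - meanProfile ψ ((M : ℝ) / n)) ≤ C * a ^ 2 := by
    have e1 := mul_le_mul_of_nonneg_left (hg _ (hmem M hM)).2 hn0.le
    have e2 : ((M : ℝ) - n * t₀) ^ 2 ≤ (a ^ 11) ^ 2 :=
      sq_le_sq' (abs_le.1 h3).1 (abs_le.1 h3).2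
    have e3 : ((M : ℝ) - n * t₀) ^ 2 / a ^ 20 ≤ a ^ 2 := by
      rw [div_le_iff₀ (by positivity)]
      calc _ ≤ _ := e2
        _ = _ := by ring
    calc _ ≤ _ := e1
      _ = C * (n * ((M : ℝ) / n - t₀) ^ 2) := by ring
      _ ≤ C * a ^ 2 := by rw [hsq]; gcongr
  have hεa : 0 ≤ ε * a ^ 10 := by positivity
  rcases lt_or_ge (a ^ 16) |(m : ℝ) - n * t₀| with hfar | hnear
  · have e1 := mul_le_mul_of_nonneg_left (hg _ (hmem m hm)).1 hn0.le
    have e2 : (a ^ 16) ^ 2 ≤ ((m : ℝ) - n * t₀) ^ 2 := by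
      rw [← sq_abs ((m : ℝ) - n * t₀)]
      exact pow_le_pow_left₀ (by positivity) hfar.le 2
    have e3 : a ^ 12 ≤ ((m : ℝ) - n * t₀) ^ 2 / a ^ 20 := by
      rw [le_div_iff₀ (by positivity)]
      calc _ = _ := by ring
        _ ≤ _ := e2
    have e4 : c * a ^ 12 ≤ n * (meanProfile ψ t₀ - meanProfile ψ ((m : ℝ) / n)) := by
      calc c * a ^ 12 ≤ c * (n * ((m : ℝ) / n - t₀) ^ 2) := by rw [hsq]; gcongr
        _ = n * (c * ((m : ℝ) / n - t₀) ^ 2) := by ring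
        _ ≤ _ := e1
    have dm := (abs_le.1 (h1 m hm)).2
    have dM := (abs_le.1 (h1 M hM)).1
    simp only [deviation] at dm dM
    have : patternCount ψ τ m - patternCount ψ τ M ≤ 2 * a ^ 11
        + n * (meanProfile ψ t₀ - meanProfile ψ ((M : ℝ) / n))
        - n * (meanProfile ψ t₀ - meanProfile ψ ((m : ℝ) / n)) := by linarith
    linarith
  · have e0 : 0 ≤ n * (meanProfile ψ t₀ - meanProfile ψ ((m : ℝ) / n)) :=
      mul_nonneg hn0.le (le_trans (by positivity) (hg _ (hmem m hm)).1)
    have hpow : a ^ 11 ≤ a ^ 16 := pow_le_pow_right₀ ha (by norm_num)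
    have b1 := abs_le.1 hnear
    have b3 := abs_le.1 h3
    -- Both times are within $a^{16}+a^{11}\le2a^{16}$ of each other; the deviation is defined for
    -- ordered times only, hence the two cases.
    have key : |patternCount ψ τ m - patternCount ψ τ M
        - n * (meanProfile ψ ((m : ℝ) / n) - meanProfile ψ ((M : ℝ) / n))| ≤ ε * a ^ 10 := by
      rcases le_total m M with h | h
      · have := h2 m M h hM (by linarith [b1.1, b3.2])
        rw [← abs_neg] at this
        convert this using 2
        rw [deviation]
        ring
      · exact h2 M m h hm (by linarith [b1.2, b3.1])
    have := (abs_le.1 key).2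
    linarith

theorem patternCount_le_max {ℓ n : ℕ} (ψ : (Fin ℓ → Bool) → ℝ) (τ : Equiv.Perm (Fin n)) {m : ℕ}
    (hm : m ≤ n) : patternCount ψ τ m ≤ maxPatternCount ψ τ :=
  Finset.le_sup' (fun m => patternCount ψ τ m) (Finset.mem_range.2 (Nat.lt_succ_of_le hm))

theorem exists_maxPatternCount_eq {ℓ n : ℕ} (ψ : (Fin ℓ → Bool) → ℝ) (τ : Equiv.Perm (Fin n)) :
    ∃ m ≤ n, maxPatternCount ψ τ = patternCount ψ τ m := by
  obtain ⟨m, hm, h⟩ := Finset.exists_mem_eq_sup' (Finset.nonempty_range_add_one (n := n))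
    (fun m => patternCount ψ τ m)
  exact ⟨m, Nat.lt_succ_iff.1 (Finset.mem_range.1 hm), h⟩

/-- The gap between the normalized maximum and the normalized value at time `m`. -/
def maxGap {ℓ : ℕ} (ψ : (Fin ℓ → Bool) → ℝ) (t₀ : ℝ) {n : ℕ} (τ : Equiv.Perm (Fin n)) (m : ℕ) : ℝ :=
  normalizedMax ψ t₀ n τ - normalizedSum ψ t₀ (indicator τ m)

theorem maxGap_eq {ℓ : ℕ} (ψ : (Fin ℓ → Bool) → ℝ) (t₀ : ℝ) {n : ℕ} (τ : Equiv.Perm (Fin n))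
    (m : ℕ) :
    maxGap ψ t₀ τ m = (√(n : ℝ))⁻¹ * (maxPatternCount ψ τ - patternCount ψ τ m) := by
  rw [maxGap, normalizedMax, normalizedSum, patternCount]
  ring

theorem maxGap_nonneg {ℓ : ℕ} (ψ : (Fin ℓ → Bool) → ℝ) (t₀ : ℝ) {n : ℕ} (τ : Equiv.Perm (Fin n))
    {m : ℕ} (hm : m ≤ n) : 0 ≤ maxGap ψ t₀ τ m := by
  rw [maxGap_eq]
  exact mul_nonneg (by positivity) (sub_nonneg.2 (patternCount_le_max ψ τ hm))

theorem abs_patternCount_le {ℓ n : ℕ} (ψ : (Fin ℓ → Bool) → ℝ) {K : ℝ} (hK : ∀ y, |ψ y| ≤ K)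
    (τ : Equiv.Perm (Fin n)) (m : ℕ) : |patternCount ψ τ m| ≤ n * K := by
  rw [patternCount, localSum]
  refine (Finset.abs_sum_le_sum_abs _ _).trans
    ((Finset.sum_le_card_nsmul _ _ K fun k _ => hK _).trans ?_)
  simp

theorem maxGap_le {ℓ n : ℕ} (ψ : (Fin ℓ → Bool) → ℝ) (t₀ : ℝ) {K : ℝ} (hK : ∀ y, |ψ y| ≤ K)
    (hn : 0 < n) (τ : Equiv.Perm (Fin n)) (m : ℕ) : maxGap ψ t₀ τ m ≤ 2 * K * √(n : ℝ) := by
  obtain ⟨m', _, h⟩ := exists_maxPatternCount_eq ψ τ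
  have hn0 : (0 : ℝ) < n := by exact_mod_cast hn
  have hr0 : 0 < √(n : ℝ) := Real.sqrt_pos.2 hn0
  have h1 := (abs_le.1 (abs_patternCount_le ψ hK τ m')).2
  have h2 := (abs_le.1 (abs_patternCount_le ψ hK τ m)).1
  rw [maxGap_eq, h, inv_mul_le_iff₀ hr0]
  calc _ ≤ 2 * K * (n : ℝ) := by linarith
    _ = 2 * K * (√(n : ℝ) * √(n : ℝ)) := by rw [Real.mul_self_sqrt hn0.le]
    _ = _ := by ring

/-- The number of bad events for the permutation. -/
def badCount {ℓ : ℕ} (ψ : (Fin ℓ → Bool) → ℝ) (a ε : ℝ) {n : ℕ} (τ : Equiv.Perm (Fin n)) : ℝ :=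
  (∑ m ∈ Finset.range (n + 1), if a ^ 11 < |deviation ψ τ 0 m| then (1 : ℝ) else 0)
    + ∑ p ∈ (Finset.range (n + 1) ×ˢ Finset.range (n + 1)).filter
        (fun p => p.1 ≤ p.2 ∧ (p.2 : ℝ) - p.1 ≤ 2 * a ^ 16),
      if ε * a ^ 10 < |deviation ψ τ p.1 p.2| then (1 : ℝ) else 0

theorem sum_boole_lt_one {κ : Type*} {s : Finset κ} {p : κ → Prop} [DecidablePred p]
    (h : ∑ k ∈ s, (if p k then (1 : ℝ) else 0) < 1) {k : κ} (hk : k ∈ s) : ¬p k := by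
  intro hp
  have := Finset.single_le_sum (f := fun k => if p k then (1 : ℝ) else 0)
    (fun k _ => by split_ifs <;> norm_num) hk
  simp only [hp, if_true] at this
  linarith

theorem badCount_nonneg {ℓ : ℕ} (ψ : (Fin ℓ → Bool) → ℝ) (a ε : ℝ) {n : ℕ}
    (τ : Equiv.Perm (Fin n)) : 0 ≤ badCount ψ a ε τ :=
  add_nonneg (Finset.sum_nonneg fun _ _ => by split_ifs <;> norm_num)
    (Finset.sum_nonneg fun _ _ => by split_ifs <;> norm_num)

/-- Without bad events the gap is at most $2\varepsilon$. Otherwise the number of bad events is at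
least 1 and multiplies the trivial bound $2K\sqrt n=2Ka^{10}$. Counting the events amounts to a
union bound once means are taken. -/
theorem maxGap_pow_le {ℓ n : ℕ} {ψ : (Fin ℓ → Bool) → ℝ} {a t₀ c C ε K : ℝ}
    (hK : ∀ y, |ψ y| ≤ K) (ha : 1 ≤ a) (han : a ^ 20 = n) (hc : 0 < c) (hε : 0 ≤ ε) (hC : 0 ≤ C)
    (hg : ∀ t ∈ Set.Icc (0 : ℝ) 1,
      c * (t - t₀) ^ 2 ≤ meanProfile ψ t₀ - meanProfile ψ t ∧
      meanProfile ψ t₀ - meanProfile ψ t ≤ C * (t - t₀) ^ 2)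
    (hbig1 : 2 * a ^ 11 + C * a ^ 2 ≤ c * a ^ 12) (hbig2 : C * a ^ 2 ≤ ε * a ^ 10)
    (τ : Equiv.Perm (Fin n)) {M : ℕ} (hM : M ≤ n) (q : ℕ) :
    |maxGap ψ t₀ τ M| ^ q ≤ (2 * ε) ^ q + (2 * K * a ^ 10) ^ q
      * (badCount ψ a ε τ + if a ^ 11 < |(M : ℝ) - n * t₀| then 1 else 0) := by
  have hK0 : 0 ≤ K := (abs_nonneg _).trans (hK fun _ => true)
  have ha0 : 0 < a := zero_lt_one.trans_le ha
  have hn0 : (0 : ℝ) < n := by rw [← han]; positivity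
  have hsqrt : √(n : ℝ) = a ^ 10 := by
    rw [← han, show a ^ 20 = (a ^ 10) ^ 2 by ring, Real.sqrt_sq (by positivity)]
  have hbc := badCount_nonneg ψ a ε τ
  rw [abs_of_nonneg (maxGap_nonneg ψ t₀ τ hM)]
  by_cases hgood : badCount ψ a ε τ < 1 ∧ |(M : ℝ) - n * t₀| ≤ a ^ 11
  · obtain ⟨hb, h3⟩ := hgood
    have hfirst : 0 ≤ ∑ m ∈ Finset.range (n + 1),
        if a ^ 11 < |deviation ψ τ 0 m| then (1 : ℝ) else 0 :=
      Finset.sum_nonneg fun _ _ => by split_ifs <;> norm_num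
    have hsecond : 0 ≤ ∑ p ∈ (Finset.range (n + 1) ×ˢ Finset.range (n + 1)).filter
        (fun p => p.1 ≤ p.2 ∧ (p.2 : ℝ) - p.1 ≤ 2 * a ^ 16),
        if ε * a ^ 10 < |deviation ψ τ p.1 p.2| then (1 : ℝ) else 0 :=
      Finset.sum_nonneg fun _ _ => by split_ifs <;> norm_num
    rw [badCount] at hb
    have h1 : ∀ m ≤ n, |deviation ψ τ 0 m| ≤ a ^ 11 := fun m hm =>
      not_lt.1 (sum_boole_lt_one (p := fun m => a ^ 11 < |deviation ψ τ 0 m|)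
        ((le_add_of_nonneg_right hsecond).trans_lt hb) (Finset.mem_range.2 (Nat.lt_succ_of_le hm)))
    have h2 : ∀ m m', m ≤ m' → m' ≤ n → (m' : ℝ) - m ≤ 2 * a ^ 16 →
        |deviation ψ τ m m'| ≤ ε * a ^ 10 := fun m m' hmm hm' hd =>
      not_lt.1 (sum_boole_lt_one
        (p := fun p : ℕ × ℕ => ε * a ^ 10 < |deviation ψ τ p.1 p.2|)
        ((le_add_of_nonneg_left hfirst).trans_lt hb) (k := (m, m'))
        (Finset.mem_filter.2 ⟨Finset.mem_product.2
          ⟨Finset.mem_range.2 (Nat.lt_succ_of_le (hmm.trans hm')),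
            Finset.mem_range.2 (Nat.lt_succ_of_le hm')⟩, hmm, hd⟩))
    have hgap : maxGap ψ t₀ τ M ≤ 2 * ε := by
      obtain ⟨m, hm, hmax⟩ := exists_maxPatternCount_eq ψ τ
      rw [maxGap_eq, hmax, hsqrt, inv_mul_le_iff₀ (by positivity)]
      have := patternCount_sub_le_of_deviation_le ha han hc hε hg hC h1 h2 hM h3 hbig1 hbig2 hm
      linarith
    have h4 := pow_le_pow_left₀ (maxGap_nonneg ψ t₀ τ hM) hgap q
    refine h4.trans (le_add_of_nonneg_right (mul_nonneg (by positivity) (add_nonneg hbc ?_)))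
    split_ifs <;> norm_num
  · have hone : 1 ≤ badCount ψ a ε τ + if a ^ 11 < |(M : ℝ) - n * t₀| then (1 : ℝ) else 0 := by
      rw [not_and_or, not_lt, not_le] at hgood
      rcases hgood with h | h
      · have : (0 : ℝ) ≤ if a ^ 11 < |(M : ℝ) - n * t₀| then (1 : ℝ) else 0 := by
          split_ifs <;> norm_num
        linarith
      · rw [if_pos h]; linarith
    have hle := maxGap_le ψ t₀ hK (by exact_mod_cast hn0) τ M
    rw [hsqrt] at hle
    have h4 := pow_le_pow_left₀ (maxGap_nonneg ψ t₀ τ hM) hle q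
    calc _ ≤ (2 * K * a ^ 10) ^ q * 1 := by rw [mul_one]; exact h4
      _ ≤ (2 * K * a ^ 10) ^ q
          * (badCount ψ a ε τ + if a ^ 11 < |(M : ℝ) - n * t₀| then 1 else 0) := by gcongr
      _ ≤ _ := le_add_of_nonneg_left (by positivity)

/-- With $\lambda=a^{-10}$ for intervals from 0 and $\lambda=a^{-8}$ for short ones,
$\lambda^2(m'-m)\le2$, while $\lambda$ times the threshold is at least $a$. There are at most
$2(n+1)^2$ events, each of probability at most $2(n+1)^2Ee^{-a}$. -/
theorem permMean_badCount_le {ℓ n : ℕ} (hℓ : 0 < ℓ) (hn : ℓ ≤ n) {ψ : (Fin ℓ → Bool) → ℝ}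
    {a ε K : ℝ} (hK : ∀ y, |ψ y| ≤ K) (ha : 1 ≤ a) (han : a ^ 20 = n)
    (hsmall : 2 * ℓ * (4 * K) ≤ a ^ 8) (hεa : a ≤ ε * a ^ 2) :
    permMean (badCount ψ a ε (n := n))
      ≤ 4 * ((n : ℝ) + 1) ^ 4 * Real.exp ((2 * ℓ) ^ 2 * (4 * K ^ 2 * ℓ) * 2) * Real.exp (-a) := by
  have hK0 : 0 ≤ K := (abs_nonneg _).trans (hK fun _ => true)
  have ha0 : 0 < a := zero_lt_one.trans_le ha
  have hn1 : (1 : ℝ) ≤ n + 1 := by linarith [Nat.cast_nonneg (α := ℝ) n]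
  set E := Real.exp ((2 * ℓ) ^ 2 * (4 * K ^ 2 * ℓ) * 2) with hE
  have hfar : ∀ m ∈ Finset.range (n + 1), permMean (fun τ : Equiv.Perm (Fin n) =>
      if a ^ 11 < |deviation ψ τ 0 m| then (1 : ℝ) else 0)
        ≤ 2 * ((n : ℝ) + 1) ^ 2 * E * Real.exp (-a) := by
    intro m hm
    have hm' : m ≤ n := Nat.lt_succ_iff.1 (Finset.mem_range.1 hm)
    have hmr : (m : ℝ) ≤ a ^ 20 := by rw [han]; exact_mod_cast hm'
    have hlam : 2 * ℓ * (a ^ 10)⁻¹ * (4 * K) ≤ 1 := by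
      have : a ^ 8 ≤ a ^ 10 := pow_le_pow_right₀ ha (by norm_num)
      calc 2 * ℓ * (a ^ 10)⁻¹ * (4 * K) = (2 * ℓ * (4 * K)) / a ^ 10 := by ring
        _ ≤ 1 := by rw [div_le_one (by positivity)]; linarith
    refine (permMean_lt_abs_deviation_le hℓ hn ψ hK (Nat.zero_le m) hm'
      (lam := (a ^ 10)⁻¹) (by positivity) hlam (a ^ 11)).trans ?_
    have e1 : (a ^ 10)⁻¹ * a ^ 11 = a := by field_simp
    rw [e1]
    gcongr
    refine Real.exp_le_exp.2 ?_
    rw [Nat.cast_zero, sub_zero]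
    calc (2 * ℓ * (a ^ 10)⁻¹) ^ 2 * (4 * K ^ 2 * ℓ * m)
        ≤ (2 * ℓ * (a ^ 10)⁻¹) ^ 2 * (4 * K ^ 2 * ℓ * a ^ 20) := by gcongr
      _ = (2 * ℓ) ^ 2 * (4 * K ^ 2 * ℓ) * 1 := by field_simp
      _ ≤ (2 * ℓ) ^ 2 * (4 * K ^ 2 * ℓ) * 2 := by gcongr; norm_num
  have hnear : ∀ p ∈ (Finset.range (n + 1) ×ˢ Finset.range (n + 1)).filter
        (fun p => p.1 ≤ p.2 ∧ (p.2 : ℝ) - p.1 ≤ 2 * a ^ 16),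
      permMean (fun τ : Equiv.Perm (Fin n) =>
        if ε * a ^ 10 < |deviation ψ τ p.1 p.2| then (1 : ℝ) else 0)
        ≤ 2 * ((n : ℝ) + 1) ^ 2 * E * Real.exp (-a) := by
    rintro ⟨m, m'⟩ hp
    obtain ⟨hp1, hmm, hd⟩ := Finset.mem_filter.1 hp
    have hm' : m' ≤ n := Nat.lt_succ_iff.1 (Finset.mem_range.1 (Finset.mem_product.1 hp1).2)
    simp only at hmm hd ⊢
    have hlam : 2 * ℓ * (a ^ 8)⁻¹ * (4 * K) ≤ 1 := by
      calc 2 * ℓ * (a ^ 8)⁻¹ * (4 * K) = (2 * ℓ * (4 * K)) / a ^ 8 := by ring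
        _ ≤ 1 := by rw [div_le_one (by positivity)]; exact hsmall
    refine (permMean_lt_abs_deviation_le hℓ hn ψ hK hmm hm'
      (lam := (a ^ 8)⁻¹) (by positivity) hlam (ε * a ^ 10)).trans ?_
    have e1 : (a ^ 8)⁻¹ * (ε * a ^ 10) = ε * a ^ 2 := by field_simp
    rw [e1]
    gcongr
    refine Real.exp_le_exp.2 ?_
    calc (2 * ℓ * (a ^ 8)⁻¹) ^ 2 * (4 * K ^ 2 * ℓ * ((m' : ℝ) - m))
        ≤ (2 * ℓ * (a ^ 8)⁻¹) ^ 2 * (4 * K ^ 2 * ℓ * (2 * a ^ 16)) := by gcongr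
      _ = _ := by field_simp
  unfold badCount
  rw [permMean_add, permMean_sum, permMean_sum]
  have s1 := Finset.sum_le_card_nsmul _ _ _ hfar
  have s2 := Finset.sum_le_card_nsmul _ _ _ hnear
  rw [nsmul_eq_mul] at s1 s2
  have hcard : (((Finset.range (n + 1) ×ˢ Finset.range (n + 1)).filter
        (fun p => p.1 ≤ p.2 ∧ (p.2 : ℝ) - p.1 ≤ 2 * a ^ 16)).card : ℝ) ≤ ((n : ℝ) + 1) ^ 2 := by
    have := Finset.card_filter_le (Finset.range (n + 1) ×ˢ Finset.range (n + 1))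
      (fun p => p.1 ≤ p.2 ∧ (p.2 : ℝ) - p.1 ≤ 2 * a ^ 16)
    rw [Finset.card_product, Finset.card_range] at this
    rw [sq]
    exact_mod_cast this
  have hT : 0 ≤ 2 * ((n : ℝ) + 1) ^ 2 * E * Real.exp (-a) := by positivity
  have s3 := s2.trans (mul_le_mul_of_nonneg_right hcard hT)
  rw [Finset.card_range] at s1
  push_cast at s1
  have hpow : (n : ℝ) + 1 ≤ (n + 1) ^ 2 := by nlinarith
  have s4 := s1.trans (mul_le_mul_of_nonneg_right hpow hT)
  calc _ ≤ _ := add_le_add s4 s3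
    _ = _ := by ring

/-- The maximum is close to the value at an independent binomial time. -/
theorem tendsto_maxGap_moment {ℓ : ℕ} (hℓ : 0 < ℓ) {ψ : (Fin ℓ → Bool) → ℝ} {t₀ : ℝ}
    (ht₀ : t₀ ∈ Set.Ioo (0 : ℝ) 1)
    (hmax : ∀ t ∈ Set.Icc (0 : ℝ) 1, t ≠ t₀ → meanProfile ψ t < meanProfile ψ t₀)
    (hsecond : iteratedDeriv 2 (meanProfile ψ) t₀ < 0) {q : ℕ} (hq : q ≠ 0) :
    Tendsto (fun n : ℕ => iidMean (bern t₀) fun x : Fin n → Bool =>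
      permMean fun τ : Equiv.Perm (Fin n) => |maxGap ψ t₀ τ (onesCount x)| ^ q) atTop (𝓝 0) := by
  obtain ⟨K, hK⟩ : ∃ K, ∀ y, |ψ y| ≤ K :=
    ⟨∑ y, |ψ y|, fun y => Finset.single_le_sum (f := fun y => |ψ y|)
      (fun _ _ => abs_nonneg _) (Finset.mem_univ y)⟩
  have hK0 : 0 ≤ K := (abs_nonneg _).trans (hK fun _ => true)
  have ht : t₀ ∈ Set.Icc (0 : ℝ) 1 := Set.Ioo_subset_Icc_self ht₀
  have hw := sum_bern t₀
  have hw0 := bern_nonneg ht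
  obtain ⟨c, C', hc, hg'⟩ := exists_quadratic_bounds ht₀ hmax hsecond
  obtain ⟨C, hC, hg⟩ : ∃ C : ℝ, 0 ≤ C ∧ ∀ t ∈ Set.Icc (0 : ℝ) 1,
      c * (t - t₀) ^ 2 ≤ meanProfile ψ t₀ - meanProfile ψ t ∧
      meanProfile ψ t₀ - meanProfile ψ t ≤ C * (t - t₀) ^ 2 :=
    ⟨max C' 0, le_max_right _ _, fun t h => ⟨(hg' t h).1, (hg' t h).2.trans
      (mul_le_mul_of_nonneg_right (le_max_left _ _) (sq_nonneg _))⟩⟩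
  set E := Real.exp ((2 * ℓ) ^ 2 * (4 * K ^ 2 * ℓ) * 2) with hE
  -- the bound in terms of the twentieth root of `n`
  have hbound : ∀ ε : ℝ, 0 < ε → ∀ᶠ a : ℝ in atTop, ∀ n : ℕ, a ^ 20 = n →
      iidMean (bern t₀) (fun x : Fin n → Bool =>
        permMean fun τ : Equiv.Perm (Fin n) => |maxGap ψ t₀ τ (onesCount x)| ^ q)
      ≤ (2 * ε) ^ q + (2 * K) ^ q * (4 * 2 ^ 4 * E + 2 * Real.exp 4)
          * (a ^ (10 * q + 80) * Real.exp (-a)) := by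
    intro ε hε
    filter_upwards [eventually_ge_atTop (1 : ℝ), eventually_ge_atTop ((2 + C) / c),
      eventually_ge_atTop (C / ε), eventually_ge_atTop (1 / ε), eventually_ge_atTop (2 : ℝ),
      eventually_ge_atTop (2 * ℓ * (4 * K)), eventually_ge_atTop (ℓ : ℝ)]
      with a ha hac haC haε ha2 haK haℓ n han
    have ha0 : 0 < a := zero_lt_one.trans_le ha
    rw [div_le_iff₀ hc] at hac
    rw [div_le_iff₀ hε] at haC haε
    have hale : ∀ k : ℕ, k ≠ 0 → a ≤ a ^ k := fun k hk => le_self_pow₀ ha hk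
    have hbig1 : 2 * a ^ 11 + C * a ^ 2 ≤ c * a ^ 12 := by
      have : a ^ 2 ≤ a ^ 11 := pow_le_pow_right₀ ha (by norm_num)
      calc 2 * a ^ 11 + C * a ^ 2 ≤ 2 * a ^ 11 + C * a ^ 11 := by gcongr
        _ = (2 + C) * a ^ 11 := by ring
        _ ≤ (a * c) * a ^ 11 := by gcongr
        _ = _ := by ring
    have hbig2 : C * a ^ 2 ≤ ε * a ^ 10 := by
      calc C * a ^ 2 ≤ (a * ε) * a ^ 2 := by gcongr
        _ = ε * a ^ 3 := by ring
        _ ≤ ε * a ^ 10 :=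
          mul_le_mul_of_nonneg_left (pow_le_pow_right₀ ha (by norm_num)) hε.le
    have hεa : a ≤ ε * a ^ 2 := by
      calc a = 1 * a := (one_mul a).symm
        _ ≤ (a * ε) * a := by gcongr
        _ = _ := by ring
    have hn : ℓ ≤ n := by
      have : (ℓ : ℝ) ≤ n := by rw [← han]; exact haℓ.trans (hale 20 (by norm_num))
      exact_mod_cast this
    have hbad := permMean_badCount_le hℓ hn hK ha han (haK.trans (hale 8 (by norm_num))) hεa
    have hcount := iidMean_lt_abs_onesCount_le (n := n) ht (lam := (a ^ 10)⁻¹) (by positivity)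
      (by rw [← div_eq_mul_inv, div_le_one (by positivity)]
          exact ha2.trans (hale 10 (by norm_num))) (a ^ 11)
    have e1 : (a ^ 10)⁻¹ * a ^ 11 = a := by field_simp
    have e2 : (2 * (a ^ 10)⁻¹) ^ 2 * (n : ℝ) = 4 := by rw [← han]; field_simp; norm_num
    rw [e1, e2] at hcount
    have hpt : ∀ x : Fin n → Bool,
        (permMean fun τ : Equiv.Perm (Fin n) => |maxGap ψ t₀ τ (onesCount x)| ^ q)
        ≤ (2 * ε) ^ q + (2 * K * a ^ 10) ^ q * (permMean (badCount ψ a ε (n := n))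
          + if a ^ 11 < |(onesCount x : ℝ) - n * t₀| then 1 else 0) := by
      intro x
      refine (permMean_mono fun τ => maxGap_pow_le hK ha han hc hε.le hC hg hbig1 hbig2 τ
        (onesCount_le x) q).trans_eq ?_
      rw [permMean_add, permMean_const, permMean_const_mul, permMean_add, permMean_const]
    refine (iidMean_mono hw0 hpt).trans ?_
    rw [iidMean_add, iidMean_const hw, iidMean_const_mul, iidMean_add, iidMean_const hw]
    refine add_le_add le_rfl ?_
    -- Hence $(n+1)^4\le16a^{80}$; with $(a^{10})^q$ from the trivial bound this gives the exponent
    -- $10q+80$.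
    have hn1 : (n : ℝ) + 1 ≤ 2 * a ^ 20 := by
      rw [← han]; linarith [one_le_pow₀ (n := 20) ha]
    have ha80 : 1 ≤ a ^ 80 := one_le_pow₀ ha
    calc (2 * K * a ^ 10) ^ q * (permMean (badCount ψ a ε (n := n))
          + iidMean (bern t₀) fun x : Fin n → Bool =>
              if a ^ 11 < |(onesCount x : ℝ) - n * t₀| then (1 : ℝ) else 0)
        ≤ (2 * K * a ^ 10) ^ q * (4 * ((n : ℝ) + 1) ^ 4 * E * Real.exp (-a)
          + 2 * Real.exp 4 * Real.exp (-a)) := by gcongr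
      _ ≤ (2 * K * a ^ 10) ^ q * (4 * (2 * a ^ 20) ^ 4 * E * Real.exp (-a)
          + 2 * Real.exp 4 * a ^ 80 * Real.exp (-a)) := by
          have h80 : 2 * Real.exp 4 * 1 * Real.exp (-a) ≤ 2 * Real.exp 4 * a ^ 80 * Real.exp (-a) := by
            gcongr
          rw [mul_one] at h80
          gcongr
      _ = _ := by rw [mul_pow _ (a ^ 10) q, ← pow_mul, pow_add]; ring
  have hroot : Tendsto (fun n : ℕ => (n : ℝ) ^ ((1 : ℝ) / 20)) atTop atTop :=
    (tendsto_rpow_atTop (by norm_num)).comp tendsto_natCast_atTop_atTop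
  have hroot20 : ∀ n : ℕ, ((n : ℝ) ^ ((1 : ℝ) / 20)) ^ 20 = n := fun n => by
    rw [← Real.rpow_natCast, ← Real.rpow_mul (Nat.cast_nonneg n)]
    norm_num
  rw [Metric.tendsto_atTop']
  have hev : ∀ δ > 0, ∀ᶠ n : ℕ in atTop, iidMean (bern t₀) (fun x : Fin n → Bool =>
      permMean fun τ : Equiv.Perm (Fin n) => |maxGap ψ t₀ τ (onesCount x)| ^ q) < δ := by
    intro δ hδ
    -- Since $2\varepsilon\le1$ and $q\ge1$, $(2\varepsilon)^q\le2\varepsilon\le\delta/2$; the other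
    -- half of $\delta$ covers the exponentially small term.
    set ε := min 1 (δ / 2) / 2 with hε
    have hm0 : 0 < min 1 (δ / 2) := lt_min one_pos (by linarith)
    have hε0 : 0 < ε := by positivity
    have hεq : (2 * ε) ^ q ≤ δ / 2 := by
      have : 2 * ε = min 1 (δ / 2) := by rw [hε]; ring
      rw [this]
      exact (pow_le_of_le_one hm0.le (min_le_left _ _) hq).trans (min_le_right _ _)
    have hlim : Tendsto (fun a : ℝ => (2 * K) ^ q * (4 * 2 ^ 4 * E + 2 * Real.exp 4)
          * (a ^ (10 * q + 80) * Real.exp (-a))) atTop (𝓝 0) := by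
      simpa using (Real.tendsto_pow_mul_exp_neg_atTop_nhds_zero (10 * q + 80)).const_mul
        ((2 * K) ^ q * (4 * 2 ^ 4 * E + 2 * Real.exp 4))
    filter_upwards [hroot.eventually (hbound ε hε0),
      hroot.eventually (hlim.eventually_lt_const (half_pos hδ))] with n h1 h2
    linarith [h1 n (hroot20 n)]
  intro δ hδ
  obtain ⟨N, hN⟩ := eventually_atTop.1 (hev δ hδ)
  refine ⟨N, fun n hn => ?_⟩
  rw [Real.dist_eq, sub_zero, abs_of_nonneg]
  · exact hN n hn.le
  · exact iidMean_nonneg hw0 fun x => permMean_nonneg fun τ => by positivity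

/-! ### Convergence of moments -/

/-- Truncation only acts where $|x|>L$, and there one more factor $|x|/L$ can be afforded. Hence a
bound on the moment of order $r+1$ controls the truncation error for order $r$. -/
theorem abs_pow_sub_clamp_pow_le {L : ℝ} (hL : 0 < L) (x : ℝ) (r : ℕ) :
    |x ^ r - (max (-L) (min x L)) ^ r| ≤ 2 / L * |x| ^ (r + 1) := by
  rcases le_or_gt |x| L with h | h
  · rw [min_eq_left (abs_le.1 h).2, max_eq_right (abs_le.1 h).1, sub_self, abs_zero]
    positivity
  · have hclamp : |max (-L) (min x L)| ≤ |x| := by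
      have : |max (-L) (min x L)| ≤ L :=
        abs_le.2 ⟨le_max_left _ _, max_le (by linarith) (min_le_right _ _)⟩
      linarith
    calc |x ^ r - (max (-L) (min x L)) ^ r| ≤ |x| ^ r + |max (-L) (min x L)| ^ r := by
          rw [← abs_pow, ← abs_pow]; exact abs_sub _ _
      _ ≤ |x| ^ r + |x| ^ r := by gcongr
      _ = 2 / L * (|x| ^ r * L) := by field_simp; ring
      _ ≤ 2 / L * (|x| ^ r * |x|) := by gcongr
      _ = _ := by rw [pow_succ]

/-- Convergence in distribution together with bounds on the moments implies convergence of the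
moments. -/
theorem tendsto_integral_pow_of_tendsto {μ : ℕ → ProbabilityMeasure ℝ} {ν : ProbabilityMeasure ℝ}
    (h : Tendsto μ atTop (𝓝 ν)) (r : ℕ) {C : ℝ}
    (hμi : ∀ n k, Integrable (fun x : ℝ => |x| ^ k) (μ n : Measure ℝ))
    (hνi : ∀ k, Integrable (fun x : ℝ => |x| ^ k) (ν : Measure ℝ))
    (hC : ∀ᶠ n in atTop, ∫ x, |x| ^ (r + 1) ∂(μ n : Measure ℝ) ≤ C) :
    Tendsto (fun n => ∫ x, x ^ r ∂(μ n : Measure ℝ)) atTop (𝓝 (∫ x, x ^ r ∂(ν : Measure ℝ))) := by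
  set C' := max C (∫ x, |x| ^ (r + 1) ∂(ν : Measure ℝ)) with hC'
  have hC'0 : 0 ≤ C' :=
    (integral_nonneg fun x => pow_nonneg (abs_nonneg x) _).trans (le_max_right _ _)
  rw [Metric.tendsto_atTop']
  intro δ hδ
  -- Chosen so that the truncation error $2(C'+1)/L$ is $\delta/4$; the 1 keeps `L` positive when
  -- `C'` is 0.
  set L := 8 * (C' + 1) / δ with hL
  have hL0 : 0 < L := by positivity
  let f : BoundedContinuousFunction ℝ ℝ := BoundedContinuousFunction.ofNormedAddCommGroup
    (fun x => (max (-L) (min x L)) ^ r) (by fun_prop) (L ^ r) (fun x => by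
      rw [Real.norm_eq_abs, abs_pow]
      refine pow_le_pow_left₀ (abs_nonneg _) ?_ r
      exact abs_le.2 ⟨le_max_left _ _, max_le (by linarith) (min_le_right _ _)⟩)
  have hf : ∀ x, f x = (max (-L) (min x L)) ^ r := fun x => rfl
  have htrunc : ∀ ρ : ProbabilityMeasure ℝ,
      (∀ k, Integrable (fun x : ℝ => |x| ^ k) (ρ : Measure ℝ)) →
      ∫ x, |x| ^ (r + 1) ∂(ρ : Measure ℝ) ≤ C' →
      |∫ x, x ^ r ∂(ρ : Measure ℝ) - ∫ x, f x ∂(ρ : Measure ℝ)| ≤ δ / 4 := by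
    intro ρ hρ hle
    have hi : Integrable (fun x : ℝ => x ^ r) (ρ : Measure ℝ) :=
      (hρ r).mono (by fun_prop) (ae_of_all _ fun x => by simp)
    rw [← integral_sub hi (f.integrable _), ← Real.norm_eq_abs]
    refine (norm_integral_le_integral_norm _).trans ?_
    calc ∫ x, ‖x ^ r - f x‖ ∂(ρ : Measure ℝ)
        ≤ ∫ x, 2 / L * |x| ^ (r + 1) ∂(ρ : Measure ℝ) := by
          refine integral_mono_of_nonneg (ae_of_all _ fun x => norm_nonneg _)
            ((hρ (r + 1)).const_mul _) (ae_of_all _ fun x => ?_)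
          exact abs_pow_sub_clamp_pow_le hL0 x r
      _ = 2 / L * ∫ x, |x| ^ (r + 1) ∂(ρ : Measure ℝ) := integral_const_mul _ _
      _ ≤ 2 / L * (C' + 1) := by gcongr; linarith
      _ = δ / 4 := by rw [hL]; field_simp; norm_num
  have hf_tendsto := (ProbabilityMeasure.tendsto_iff_forall_integral_tendsto.1 h) f
  have hev := (Metric.tendsto_nhds.1 hf_tendsto) (δ / 4) (by positivity)
  obtain ⟨N, hN⟩ := eventually_atTop.1 (hev.and hC)
  refine ⟨N, fun n hn => ?_⟩
  obtain ⟨h1, h2⟩ := hN n hn.le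
  have h3 := htrunc (μ n) (hμi n) (h2.trans (le_max_left _ _))
  have h4 := htrunc ν hνi (le_max_right _ _)
  rw [Real.dist_eq] at h1 ⊢
  rw [abs_lt] at h1 ⊢
  rw [abs_le] at h3 h4
  constructor <;> linarith [h1.1, h1.2, h3.1, h3.2, h4.1, h4.2]

theorem norm_exp_mul_I_sub_le (u y z : ℝ) :
    ‖Complex.exp (u * (y * Complex.I)) - Complex.exp (u * (z * Complex.I))‖ ≤ |u| * |y - z| := by
  have h1 : Complex.exp (u * (y * Complex.I)) = Complex.exp (u * (z * Complex.I))
      * Complex.exp (Complex.I * ((u * (y - z) : ℝ) : ℂ)) := by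
    rw [← Complex.exp_add]
    congr 1
    push_cast
    ring
  have h2 : (u : ℂ) * (z * Complex.I) = ((u * z : ℝ) : ℂ) * Complex.I := by push_cast; ring
  rw [h1, ← mul_sub_one, norm_mul, h2, Complex.norm_exp_ofReal_mul_I, one_mul, ← abs_mul]
  exact Real.norm_exp_I_mul_ofReal_sub_one_le

/-! ### Characteristic function and moments of the normalized maximum -/

section Limit

variable {ℓ : ℕ} {ψ : (Fin ℓ → Bool) → ℝ} {t₀ : ℝ}

/-- Replacing the maximum by the value at the binomial time changes the characteristic function by
at most $|u|$ times the mean gap, which tends to 0. -/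
theorem tendsto_charFun_normalizedMax (hℓ : 0 < ℓ) (ht₀ : t₀ ∈ Set.Ioo (0 : ℝ) 1)
    (hmax : ∀ t ∈ Set.Icc (0 : ℝ) 1, t ≠ t₀ → meanProfile ψ t < meanProfile ψ t₀)
    (hsecond : iteratedDeriv 2 (meanProfile ψ) t₀ < 0) (u : ℝ) :
    Tendsto (fun n : ℕ => permMean fun τ : Equiv.Perm (Fin n) =>
        Complex.exp (u * ((normalizedMax ψ t₀ n τ : ℝ) * Complex.I))) atTop
      (𝓝 (Complex.exp (-(limitVariance ψ t₀ * u ^ 2 / 2)))) := by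
  have ht : t₀ ∈ Set.Icc (0 : ℝ) 1 := Set.Ioo_subset_Icc_self ht₀
  have hw := sum_bern t₀
  have hw0 := bern_nonneg ht
  have hgap := (tendsto_maxGap_moment hℓ ht₀ hmax hsecond one_ne_zero).const_mul |u|
  rw [mul_zero] at hgap
  have hsub : Tendsto (fun n : ℕ =>
      (permMean fun τ : Equiv.Perm (Fin n) =>
        Complex.exp (u * ((normalizedMax ψ t₀ n τ : ℝ) * Complex.I)))
      - iidMean (bern t₀) (fun x : Fin n → Bool =>
        Complex.exp (u * ((normalizedSum ψ t₀ x : ℝ) * Complex.I)))) atTop (𝓝 0) := by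
    refine squeeze_zero_norm (fun n => ?_) hgap
    -- Coupling: the i.i.d. sequence is realized as $I_{n,M}$ for the same permutation as the
    -- maximum, and the maximum is averaged over $M$, on which it does not depend.
    rw [← iidMean_permMean_indicator (bern t₀) (fun x : Fin n → Bool =>
        Complex.exp (u * ((normalizedSum ψ t₀ x : ℝ) * Complex.I))),
      ← iidMean_const (ι := Fin n) hw (permMean fun τ : Equiv.Perm (Fin n) =>
        Complex.exp (u * ((normalizedMax ψ t₀ n τ : ℝ) * Complex.I))), ← iidMean_sub]
    refine (norm_iidMean_le hw0 _).trans ?_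
    rw [← iidMean_const_mul]
    refine iidMean_mono hw0 fun x => ?_
    rw [← permMean_sub, ← permMean_const_mul]
    refine (norm_permMean_le _).trans (permMean_mono fun τ => ?_)
    rw [pow_one]
    exact norm_exp_mul_I_sub_le _ _ _
  simpa using hsub.add (tendsto_charFun_normalizedSum hℓ ψ ht u)

/-- The maximum is the gap plus the value at the binomial time; both have bounded moments, and
$(x+y)^q\le2^{q-1}(x^q+y^q)$. -/
theorem eventually_moment_normalizedMax_le (hℓ : 0 < ℓ) (ht₀ : t₀ ∈ Set.Ioo (0 : ℝ) 1)
    (hmax : ∀ t ∈ Set.Icc (0 : ℝ) 1, t ≠ t₀ → meanProfile ψ t < meanProfile ψ t₀)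
    (hsecond : iteratedDeriv 2 (meanProfile ψ) t₀ < 0) {q : ℕ} (hq : q ≠ 0) :
    ∃ C : ℝ, ∀ᶠ n : ℕ in atTop,
      permMean (fun τ : Equiv.Perm (Fin n) => |normalizedMax ψ t₀ n τ| ^ q) ≤ C := by
  have ht : t₀ ∈ Set.Icc (0 : ℝ) 1 := Set.Ioo_subset_Icc_self ht₀
  have hw := sum_bern t₀
  have hw0 := bern_nonneg ht
  obtain ⟨C, hC⟩ := eventually_moment_normalizedSum_le hℓ ψ ht q
  have hgap := (tendsto_maxGap_moment hℓ ht₀ hmax hsecond hq).eventually_le_const zero_lt_one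
  refine ⟨2 ^ (q - 1) * (1 + C), ?_⟩
  filter_upwards [hC, hgap] with n h1 h2
  rw [← iidMean_const (ι := Fin n) hw (permMean fun τ : Equiv.Perm (Fin n) =>
    |normalizedMax ψ t₀ n τ| ^ q)]
  have hpt : ∀ x : Fin n → Bool,
      (permMean fun τ : Equiv.Perm (Fin n) => |normalizedMax ψ t₀ n τ| ^ q)
      ≤ 2 ^ (q - 1) * ((permMean fun τ : Equiv.Perm (Fin n) => |maxGap ψ t₀ τ (onesCount x)| ^ q)
        + permMean fun τ : Equiv.Perm (Fin n) =>
            |normalizedSum ψ t₀ (indicator τ (onesCount x))| ^ q) := by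
    intro x
    rw [← permMean_add, ← permMean_const_mul]
    refine permMean_mono fun τ => ?_
    refine le_trans ?_ (add_pow_le (abs_nonneg _) (abs_nonneg _) q)
    refine pow_le_pow_left₀ (abs_nonneg _) ?_ q
    refine le_trans (le_of_eq ?_) (abs_add_le _ _)
    rw [maxGap, sub_add_cancel]
  refine (iidMean_mono hw0 hpt).trans ?_
  rw [iidMean_const_mul, iidMean_add,
    iidMean_permMean_indicator (bern t₀) (fun x : Fin n → Bool => |normalizedSum ψ t₀ x| ^ q)]
  gcongr

end Limit

end

end PatternMax

theorem theorem9 (ℓ : ℕ) (hℓ : 1 ≤ ℓ) (ψ : (Fin ℓ → Bool) → ℝ) (t₀ : ℝ)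
    (ht₀ : t₀ ∈ Set.Ioo (0 : ℝ) 1)
    (hmax : ∀ t ∈ Set.Icc (0 : ℝ) 1, t ≠ t₀ →
      PatternMax.meanProfile ψ t < PatternMax.meanProfile ψ t₀)
    (hsecond : iteratedDeriv 2 (PatternMax.meanProfile ψ) t₀ < 0) :
    TendstoInDistribution (fun n => PatternMax.normalizedMax ψ t₀ n) atTop (id : ℝ → ℝ)
        PatternMax.permMeasure
        (gaussianReal 0 (PatternMax.limitVariance ψ t₀).toNNReal) ∧
      ∀ r : ℕ,
        Tendsto (fun n : ℕ => ∫ τ, PatternMax.normalizedMax ψ t₀ n τ ^ r ∂PatternMax.permMeasure n)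
          atTop (𝓝 (∫ z, z ^ r ∂gaussianReal 0 (PatternMax.limitVariance ψ t₀).toNNReal)) := by
  have ht : t₀ ∈ Set.Icc (0 : ℝ) 1 := Set.Ioo_subset_Icc_self ht₀
  have hσ := PatternMax.limitVariance_nonneg ψ ht
  have hmeas : ∀ n, Measurable (PatternMax.normalizedMax ψ t₀ n) := fun n => measurable_from_top
  have hdist : TendstoInDistribution (fun n => PatternMax.normalizedMax ψ t₀ n) atTop
      (id : ℝ → ℝ) PatternMax.permMeasure
      (gaussianReal 0 (PatternMax.limitVariance ψ t₀).toNNReal) := by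
    refine ⟨fun n => (hmeas n).aemeasurable, aemeasurable_id, ?_⟩
    -- Lévy's continuity theorem.
    refine ProbabilityMeasure.tendsto_iff_tendsto_charFun.2 fun u => ?_
    have hlim := PatternMax.tendsto_charFun_normalizedMax hℓ ht₀ hmax hsecond u
    simp only [ProbabilityMeasure.coe_mk, Measure.map_id]
    rw [charFun_gaussianReal]
    convert hlim using 1
    · ext n
      rw [charFun_apply_real, integral_map (hmeas n).aemeasurable (by fun_prop),
        PatternMax.integral_permMeasure]
      simp only [mul_assoc]
    · rw [Real.coe_toNNReal _ hσ]
      simp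
  refine ⟨hdist, fun r => ?_⟩
  -- Convergence of the moment of order `r` needs a bound on the one of order `r + 1`, which also
  -- makes the order nonzero.
  obtain ⟨C, hC⟩ := PatternMax.eventually_moment_normalizedMax_le hℓ ht₀ hmax hsecond
    (Nat.succ_ne_zero r)
  have key := PatternMax.tendsto_integral_pow_of_tendsto hdist.tendsto r (C := C)
    (fun n k => ?_) (fun k => ?_) ?_
  · simp only [ProbabilityMeasure.coe_mk, Measure.map_id] at key
    refine key.congr fun n => ?_
    exact integral_map (hmeas n).aemeasurable (by fun_prop)
  · simp only [ProbabilityMeasure.coe_mk]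
    rw [integrable_map_measure (by fun_prop) (hmeas n).aemeasurable]
    have : MeasurableSingletonClass (Equiv.Perm (Fin n)) := ⟨fun _ => trivial⟩
    exact Integrable.of_finite
  · simp only [ProbabilityMeasure.coe_mk, Measure.map_id]
    rcases Nat.eq_zero_or_pos k with rfl | hk
    · simp
    · have := (memLp_id_gaussianReal (μ := 0)
        (v := (PatternMax.limitVariance ψ t₀).toNNReal) (k : NNReal)).integrable_norm_pow'
      simpa using this
  · filter_upwards [hC] with n hn
    simp only [ProbabilityMeasure.coe_mk]
    rw [integral_map (hmeas n).aemeasurable (by fun_prop), PatternMax.integral_permMeasure]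
    exact hn
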